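/- **Theorem 6.1.** Let $H$ be a separable Hilbert space, let $0<s\le 2$, and let $m\ge1$, $n_0\ge1$ be integers. *Notation.* Write $s=k+\alpha$ with $k=\lceil s\rceil-1$ and $0<\alpha\le1$. Let $\mathcal F_s$ be the set of $k$ times continuously (real Fréchet) differentiable functions $f:H\to\mathbb R$ with $\|D^kf(x)-D^kf(y)\|\le\|x-y\|^{\alpha}$ for all $x,y\in H$, and for random variables $X,Y$ in $H$ let $$\zeta_s(X,Y)=\zeta_s(\mathcal L(X),\mathcal L(Y))=\sup_{f\in\mathcal F_s}|\mathbb E f(X)-\mathbb E f(Y)|.$$ Let $\mathcal P_s$ be the set of probability measures $\mathcal L(Z)$ on $H$ with $\mathbb E\|Z\|^s<\infty$ and, for $s>1$, let $\mathcal P_{s,0}$ be the set of those with also $\mathbb E Z=0$. A random linear operator in $H$ is a map $A$ from a probability space to the bounded linear operators on $H$ such that $Ax$ is a random variable for every $x\in H$; the $\sigma$-algebra it generates is the one generated by all $Ax$, $x\in H$. A random variable $Y$ in $H$ or a random linear operator $A$ is $s$-integrable if $\mathbb E\|Y\|^s<\infty$, respectively $\mathbb E\|A\|_{\rm op}^s<\infty$.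 *Recurrence.* Let $(X_n)_{n\ge0}$ be $s$-integrable random variables in $H$ such that $$X_n\stackrel{d}{=}\sum_{r=1}^m A_r^{(n)}\bigl(X^{(r)}_{I_r^{(n)}}\bigr)+b^{(n)},\qquad n\ge n_0,$$ where the $A_r^{(n)}$ are $s$-integrable random linear operators in $H$, the $b^{(n)}$ are $s$-integrable random variables in $H$, the $I_r^{(n)}$ are random integers in $\{0,\dots,n\}$, $\mathcal L(X_j^{(r)})=\mathcal L(X_j)$ for all $r$ and $j$, and for each $n\ge n_0$ the sequences $(X_j^{(1)})_{j\ge0},\dots,(X_j^{(m)})_{j\ge0}$ and the vector $(A_1^{(n)},\dots,A_m^{(n)},b^{(n)},I_1^{(n)},\dots,I_m^{(n)})$ are independent. If $1<s\le2$, assume also that $\mathbb E X_n=0$ for all $n\ge0$. *Assumptions.* Suppose that there are random linear operators $A_1^*,\dots,A_m^*$ in $H$ and a random variable $b^*$ in $H$, on the same probability space as the coefficients, such that, as $n\to\infty$, $$\mathbb E\|A_r^{(n)}-A_r^*\|_{\rm op}^s\to0,\qquad \mathbb E\|b^{(n)}-b^*\|^s\to0,\qquad \mathbb E\sum_{r=1}^m\|A_r^*\|_{\rm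 op}^s<1,$$ $$\mathbb E\bigl[\mathbf 1_{\{I_r^{(n)}\le\ell\}}\|A_r^{(n)}\|_{\rm op}^s\bigr]\to0$$ for all $\ell\in\mathbb N$ and $r=1,\dots,m$. *Conclusion.* The map $$T:\ \mathcal L(Z)\mapsto\mathcal L\Bigl(\sum_{r=1}^m A_r^*(Z^{(r)})+b^*\Bigr),$$ where $(A_1^*,\dots,A_m^*,b^*),Z^{(1)},\dots,Z^{(m)}$ are independent and $\mathcal L(Z^{(r)})=\mathcal L(Z)$, has a unique fixed point $\mathcal L(X)$ in $\mathcal P_s$ if $0<s\le1$, and in $\mathcal P_{s,0}$ if $1<s\le2$; and $$\zeta_s(X_n,X)\to0,\qquad n\to\infty.$$ -/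

import Mathlib

open MeasureTheory ProbabilityTheory Filter Topology
open scoped ENNReal

namespace HilbertContraction

noncomputable section

/-- The class `F_s` of test functions on a real normed space `B`. With `s = m + α`, `0 < α ≤ 1`
and `m = ⌈s⌉ - 1`, these are the functions `f : B → ℝ` of class `C^m` (real Fréchet derivatives)
such that `‖D^m f(x) - D^m f(y)‖ ≤ ‖x - y‖^α` for all `x, y`. It is meant for `s > 0`. -/
def testFunctions (B : Type*) [NormedAddCommGroup B] [NormedSpace ℝ B] (s : ℝ) : Set (B → ℝ) :=
  {f | ContDiff ℝ ((⌈s⌉₊ - 1 : ℕ) : WithTop ℕ∞) f ∧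
    ∀ x y : B, ‖iteratedFDeriv ℝ (⌈s⌉₊ - 1) f x - iteratedFDeriv ℝ (⌈s⌉₊ - 1) f y‖
      ≤ ‖x - y‖ ^ (s - ((⌈s⌉₊ - 1 : ℕ) : ℝ))}

/-- The Zolotarev distance `ζ_s(μ, ν) = sup_{f ∈ F_s} |∫ f dμ - ∫ f dν|`, with values in
`[0, ∞]`. On a separable space, every `f ∈ F_s` is integrable with respect to every probability
measure with finite `s`-th absolute moment, so that the integrals are genuine for such
measures. -/
def zolotarev {B : Type*} [NormedAddCommGroup B] [NormedSpace ℝ B] [MeasurableSpace B]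
    (s : ℝ) (μ ν : Measure B) : ℝ≥0∞ :=
  ⨆ f ∈ testFunctions B s, ENNReal.ofReal |∫ x, f x ∂μ - ∫ x, f x ∂ν|

/-- `P_s(B)`: the probability measures on `B` with finite `s`-th absolute moment. -/
def Ps (B : Type*) [NormedAddCommGroup B] [MeasurableSpace B] (s : ℝ) : Set (Measure B) :=
  {μ | IsProbabilityMeasure μ ∧ ∫⁻ x, ‖x‖ₑ ^ s ∂μ < ∞}

/-- `P_{s,0}(B)`: the centered elements of `P_s(B)` (used for `s > 1`, where the first moment
exists). -/
def PsCentered (B : Type*) [NormedAddCommGroup B] [NormedSpace ℝ B] [MeasurableSpace B] (s : ℝ) :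
    Set (Measure B) :=
  {μ | μ ∈ Ps B s ∧ ∫ x, x ∂μ = 0}

variable {𝕜 H Ω Ω₀ : Type*} [RCLike 𝕜] [NormedAddCommGroup H] [InnerProductSpace 𝕜 H]
  [MeasurableSpace H] [MeasurableSpace Ω] [MeasurableSpace Ω₀]

/-- A random (bounded) linear operator: `ω ↦ A(ω) x` is a random variable for each `x`. This is
weaker than measurability for the Borel sets of the operator norm, and it is what multiplication
operators by random functions satisfy. -/
def IsRandomOperator (A : Ω → H →L[𝕜] H) : Prop :=
  ∀ x : H, Measurable fun ω => A ω x

/-- The `σ`-algebra generated by the coefficients `(A_1, …, A_m, b, I_1, …, I_m)`, where a random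
operator `A` generates the `σ`-algebra of all `ω ↦ A(ω) x`, `x ∈ H`. -/
abbrev coeffSigma {m : ℕ} (A : Fin m → Ω → H →L[𝕜] H) (b : Ω → H) (I : Fin m → Ω → ℕ) :
    MeasurableSpace Ω :=
  (⨆ r, ⨆ x : H, MeasurableSpace.comap (fun ω => A r ω x) inferInstance) ⊔
    MeasurableSpace.comap b inferInstance ⊔
    ⨆ r, MeasurableSpace.comap (I r) inferInstance

/-- The `σ`-algebra generated by a sequence `(Y_j)_{j ≥ 0}` of `H`-valued random variables. -/
abbrev seqSigma (Y : ℕ → Ω → H) : MeasurableSpace Ω :=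
  ⨆ j, MeasurableSpace.comap (Y j) inferInstance

/-- The map `T`: it sends `L(Z)` to the law of `∑ r, A_r (Z^{(r)}) + b`, where
`(A_1, …, A_m, b)`, `Z^{(1)}, …, Z^{(m)}` are independent and each `Z^{(r)}` has the law of `Z`.
The independent variables are realized on a product space. -/
def fixedPointMap {m : ℕ} (P : Measure Ω) (A : Fin m → Ω → H →L[𝕜] H) (b : Ω → H)
    (μ : Measure H) : Measure H :=
  (P.prod (Measure.pi fun _ : Fin m => μ)).map
    fun p : Ω × (Fin m → H) => ∑ r, A r p.1 (p.2 r) + b p.1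

/-- The recurrence `X_n =ᵈ ∑ r, A_r^{(n)} (X^{(r)}_{I_r^{(n)}}) + b^{(n)}` for `n ≥ n₀`.
Here `X n` lives on `(Ω₀, P₀)` and `Y r j` stands for `X_j^{(r)}`. -/
structure SatisfiesRecurrence {m : ℕ} (P₀ : Measure Ω₀) (P : Measure Ω) (n₀ : ℕ)
    (X : ℕ → Ω₀ → H) (A : ℕ → Fin m → Ω → H →L[𝕜] H) (b : ℕ → Ω → H) (I : ℕ → Fin m → Ω → ℕ)
    (Y : Fin m → ℕ → Ω → H) : Prop where
  measurable_X : ∀ n, Measurable (X n)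
  measurable_A : ∀ n ≥ n₀, ∀ r, IsRandomOperator (A n r)
  measurable_b : ∀ n ≥ n₀, Measurable (b n)
  measurable_I : ∀ n ≥ n₀, ∀ r, Measurable (I n r)
  measurable_Y : ∀ r j, Measurable (Y r j)
  /-- `I_r^{(n)}` takes values in `{0, …, n}`. -/
  index_le : ∀ n ≥ n₀, ∀ r, ∀ᵐ ω ∂P, I n r ω ≤ n
  /-- `X_j^{(r)}` is a copy of `X_j`. -/
  copies : ∀ r j, IdentDistrib (Y r j) (X j) P P₀
  /-- `(X_j^{(1)})_j, …, (X_j^{(m)})_j, (A^{(n)}, b^{(n)}, I^{(n)})` are independent. -/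
  indep : ∀ n ≥ n₀, iIndep
    (fun i : Option (Fin m) => i.elim (coeffSigma (A n) (b n) (I n)) fun r => seqSigma (Y r)) P
  /-- The distributional equation. -/
  recurrence : ∀ n ≥ n₀,
    IdentDistrib (X n) (fun ω => ∑ r, A n r ω (Y r (I n r ω) ω) + b n ω) P₀ P

end

end HilbertContraction

/-! The proof rests on `ζ_s` being an ideal metric. If `f` is a test function, then `x ↦ f (c + a
x)` is one up to the factor `‖a‖ ^ s` (`IsHolderSmooth.comp_affine`). Exchanging independent
summands one at a time therefore bounds the distance between two sums by the distances of the
summands, weighted with `‖a_r‖ ^ s` (`enorm_integral_pi_sub_le`). Conditioning on the coefficients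
turns this into a contraction estimate for `T` with factor `E ∑ ‖A_r^*‖ ^ s < 1`
(`zolotarev_fixedPointMap_le`) and into a recursive inequality for `ζ_s(X_n, X)`
(`SatisfiesRecurrence.zolotarev_le`).

Existence does not go through completeness of `ζ_s`. The iterates of `T` started at `0` are realized
on an `m`-ary tree of independent coefficients. Their increments follow the homogeneous recursion,
so their distance to `δ_0` decays geometrically. In a Hilbert space `‖x‖ ^ s` is a multiple of a
test function (`isHolderSmooth_norm_rpow`), so the `s`-th moments of the increments decay as well,
and the iterates converge almost surely to a solution (`exists_fixedPoint`). Uniqueness follows from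
the contraction, finiteness of `ζ_s` on the relevant laws, and separation of laws by cosines of
linear functionals.

For the limit, `d_n = ζ_s(X_n, X)` satisfies `d_n ≤ E ∑ ‖A_r^{(n)}‖ ^ s d_{I_r^{(n)}} + e_n`. The
error `e_n` comes from exchanging the coefficients for their limits and vanishes by a coupling bound
(`tendsto_zolotarev_fixedPointMap`); `tendsto_zero_of_averaged_recursion` then gives `d_n → 0`. For
`s > 1` the coupling bounds need equal means. The centering of `b^{(n)}` follows from the
recurrence, and that of `b^*` by passing to the limit. -/

namespace HilbertContraction

set_option linter.unusedSectionVars false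

/-! ### Test functions: scaling, growth and Taylor estimate -/

section HolderSmooth

variable {E F : Type*} [NormedAddCommGroup E] [NormedSpace ℝ E]
  [NormedAddCommGroup F] [NormedSpace ℝ F]

/-- Test functions of order `s` with Hölder constant `C` in place of `1`. -/
def IsHolderSmooth (s C : ℝ) (f : E → ℝ) : Prop :=
  ContDiff ℝ ((⌈s⌉₊ - 1 : ℕ) : WithTop ℕ∞) f ∧
    ∀ x y : E, ‖iteratedFDeriv ℝ (⌈s⌉₊ - 1) f x - iteratedFDeriv ℝ (⌈s⌉₊ - 1) f y‖
      ≤ C * ‖x - y‖ ^ (s - ((⌈s⌉₊ - 1 : ℕ) : ℝ))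

theorem isHolderSmooth_one_iff {s : ℝ} {f : E → ℝ} :
    IsHolderSmooth s 1 f ↔ f ∈ testFunctions E s := by
  simp [IsHolderSmooth, testFunctions]

theorem ceil_sub_one_of_le_one {s : ℝ} (hs1 : s ≤ 1) : ⌈s⌉₊ - 1 = 0 := by
  have : ⌈s⌉₊ ≤ 1 := Nat.ceil_le.2 (by simpa using hs1)
  omega

theorem ceil_sub_one_of_one_lt {s : ℝ} (hs : 1 < s) (hs2 : s ≤ 2) : ⌈s⌉₊ - 1 = 1 := by
  have h1 : ⌈s⌉₊ ≤ 2 := Nat.ceil_le.2 (by simpa using hs2)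
  have h2 : 1 < ⌈s⌉₊ := Nat.lt_ceil.2 (by simpa using hs)
  omega

theorem isHolderSmooth_iff_of_le_one {s C : ℝ} (hs1 : s ≤ 1) {f : E → ℝ} :
    IsHolderSmooth s C f ↔ Continuous f ∧ ∀ x y, |f x - f y| ≤ C * ‖x - y‖ ^ s := by
  unfold IsHolderSmooth
  have hk := ceil_sub_one_of_le_one hs1
  generalize ⌈s⌉₊ - 1 = k at hk
  subst hk
  refine and_congr (by simp [contDiff_zero]) (forall₂_congr fun x y => ?_)
  rw [iteratedFDeriv_zero_eq_comp]
  simp only [Function.comp_apply]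
  rw [← map_sub, LinearIsometryEquiv.norm_map, Real.norm_eq_abs]
  simp

theorem norm_iteratedFDeriv_one_sub (f : E → F) (x y : E) :
    ‖iteratedFDeriv ℝ 1 f x - iteratedFDeriv ℝ 1 f y‖ = ‖fderiv ℝ f x - fderiv ℝ f y‖ := by
  have h : ∀ v : Fin 1 → E, (iteratedFDeriv ℝ 1 f x - iteratedFDeriv ℝ 1 f y) v
      = (fderiv ℝ f x - fderiv ℝ f y) (v 0) := fun v => by
    simp [iteratedFDeriv_one_apply]
  refine le_antisymm ?_ ?_
  · refine ContinuousMultilinearMap.opNorm_le_bound (norm_nonneg _) fun v => ?_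
    rw [h]
    simpa using (fderiv ℝ f x - fderiv ℝ f y).le_opNorm (v 0)
  · refine ContinuousLinearMap.opNorm_le_bound _ (norm_nonneg _) fun v => ?_
    rw [← h fun _ => v]
    simpa using (iteratedFDeriv ℝ 1 f x - iteratedFDeriv ℝ 1 f y).le_opNorm fun _ => v

theorem isHolderSmooth_iff_of_one_lt {s C : ℝ} (hs : 1 < s) (hs2 : s ≤ 2) {f : E → ℝ} :
    IsHolderSmooth s C f ↔
      ContDiff ℝ 1 f ∧ ∀ x y, ‖fderiv ℝ f x - fderiv ℝ f y‖ ≤ C * ‖x - y‖ ^ (s - 1) := by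
  unfold IsHolderSmooth
  have hk := ceil_sub_one_of_one_lt hs hs2
  generalize ⌈s⌉₊ - 1 = k at hk
  subst hk
  refine and_congr (by simp) (forall₂_congr fun x y => ?_)
  rw [norm_iteratedFDeriv_one_sub]
  simp

theorem IsHolderSmooth.const_mul {s C : ℝ} {f : E → ℝ} (hf : IsHolderSmooth s C f) (a : ℝ) :
    IsHolderSmooth s (|a| * C) fun x => a * f x := by
  refine ⟨contDiff_const.mul hf.1, fun x y => ?_⟩
  have h : ∀ z, iteratedFDeriv ℝ (⌈s⌉₊ - 1) (fun x => a * f x) z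
      = a • iteratedFDeriv ℝ (⌈s⌉₊ - 1) f z := fun z =>
    iteratedFDeriv_const_smul_apply (a := a) (f := f) hf.1.contDiffAt
  rw [h, h, ← smul_sub, norm_smul, mul_assoc, Real.norm_eq_abs]
  exact mul_le_mul_of_nonneg_left (hf.2 x y) (abs_nonneg a)

/-- With `k = ⌈s⌉ - 1`, the chain rule puts `a` into each of the `k` slots of the derivative, which
costs `‖a‖ ^ k`; the Hölder condition costs another `‖a‖ ^ (s - k)`. This is the homogeneity of
order `s` of `ζ_s`. -/
theorem IsHolderSmooth.comp_affine {s C : ℝ} (hs : 0 < s) (hC : 0 ≤ C) {f : F → ℝ}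
    (hf : IsHolderSmooth s C f) (a : E →L[ℝ] F) (c : F) :
    IsHolderSmooth s (C * ‖a‖ ^ s) fun x => f (c + a x) := by
  have hg : ContDiff ℝ ((⌈s⌉₊ - 1 : ℕ) : WithTop ℕ∞) fun z => f (c + z) :=
    hf.1.comp (contDiff_const.add contDiff_id)
  refine ⟨hg.comp a.contDiff, fun x y => ?_⟩
  have h : ∀ z, iteratedFDeriv ℝ (⌈s⌉₊ - 1) (fun x => f (c + a x)) z
      = (iteratedFDeriv ℝ (⌈s⌉₊ - 1) f (c + a z)).compContinuousLinearMap fun _ => a := by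
    intro z
    have := a.iteratedFDeriv_comp_right hg z (i := ⌈s⌉₊ - 1) le_rfl
    rw [iteratedFDeriv_comp_add_left] at this
    exact this
  have hk : ((⌈s⌉₊ - 1 : ℕ) : ℝ) < s := by
    have h1 : 0 < ⌈s⌉₊ := Nat.ceil_pos.2 hs
    have h2 := Nat.ceil_lt_add_one hs.le
    rw [Nat.cast_sub h1]; push_cast; linarith
  set k := ⌈s⌉₊ - 1
  have hsub : (iteratedFDeriv ℝ k f (c + a x)).compContinuousLinearMap (fun _ => a)
      - (iteratedFDeriv ℝ k f (c + a y)).compContinuousLinearMap (fun _ => a)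
      = (iteratedFDeriv ℝ k f (c + a x) - iteratedFDeriv ℝ k f (c + a y)).compContinuousLinearMap
        fun _ => a := by
    ext v; simp
  rw [h, h, hsub]
  refine (ContinuousMultilinearMap.norm_compContinuousLinearMap_le _ _).trans ?_
  have h1 := hf.2 (c + a x) (c + a y)
  have h2 : ‖c + a x - (c + a y)‖ ≤ ‖a‖ * ‖x - y‖ := by
    rw [add_sub_add_left_eq_sub, ← map_sub]; exact a.le_opNorm _
  calc _ ≤ (C * (‖a‖ * ‖x - y‖) ^ (s - (k : ℝ))) * ‖a‖ ^ k := by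
        simp only [Finset.prod_const, Finset.card_univ, Fintype.card_fin]
        gcongr
        exact h1.trans (by gcongr)
    _ = C * ‖a‖ ^ s * ‖x - y‖ ^ (s - (k : ℝ)) := by
        rw [Real.mul_rpow (norm_nonneg _) (norm_nonneg _)]
        have : ‖a‖ ^ s = ‖a‖ ^ (s - (k : ℝ)) * ‖a‖ ^ k := by
          rw [← Real.rpow_natCast, ← Real.rpow_add' (norm_nonneg _) (by simp [hs.ne'])]
          simp
        rw [this]; ring

theorem norm_le_one_add_rpow {s : ℝ} (hs : 1 ≤ s) (x : E) : ‖x‖ ≤ 1 + ‖x‖ ^ s := by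
  rcases le_total ‖x‖ 1 with h | h
  · have := Real.rpow_nonneg (norm_nonneg x) s
    linarith
  · have := Real.rpow_le_rpow_of_exponent_le h hs
    rw [Real.rpow_one] at this
    linarith

/-- First order Taylor estimate at the origin. -/
theorem IsHolderSmooth.abs_sub_sub_fderiv_le {s : ℝ} (hs : 1 < s) (hs2 : s ≤ 2) {f : E → ℝ}
    (hf : IsHolderSmooth s 1 f) (u v : E) :
    |f u - f v - fderiv ℝ f 0 (u - v)| ≤ (‖u‖ + ‖v‖) ^ (s - 1) * ‖u - v‖ := by
  obtain ⟨h1, h2⟩ := (isHolderSmooth_iff_of_one_lt hs hs2).1 hf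
  -- Mean value inequality for `f - Df(0)` on a ball about `0` that contains both points.
  refine (convex_closedBall (0 : E) (‖u‖ + ‖v‖)).norm_image_sub_le_of_norm_fderiv_le' (𝕜 := ℝ)
    (f := f) (φ := fderiv ℝ f 0) (fun x _ => h1.differentiable one_ne_zero x)
    (fun x hx => ?_) (by simp) (by simp)
  have hx : ‖x‖ ≤ ‖u‖ + ‖v‖ := by simpa using hx
  refine (h2 x 0).trans ?_
  rw [one_mul, sub_zero]
  exact Real.rpow_le_rpow (norm_nonneg _) hx (by linarith)

theorem IsHolderSmooth.exists_abs_le {s : ℝ} (hs2 : s ≤ 2) {f : E → ℝ}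
    (hf : IsHolderSmooth s 1 f) : ∃ C : ℝ, ∀ x, |f x| ≤ C * (1 + ‖x‖ ^ s) := by
  have hp : ∀ x : E, 0 ≤ ‖x‖ ^ s := fun x => Real.rpow_nonneg (norm_nonneg x) s
  rcases le_or_gt s 1 with hs1 | hs1
  · obtain ⟨-, h⟩ := (isHolderSmooth_iff_of_le_one hs1).1 hf
    refine ⟨|f 0| + 1, fun x => ?_⟩
    have h1 := h x 0
    have h2 := abs_sub_abs_le_abs_sub (f x) (f 0)
    simp only [sub_zero, one_mul] at h1
    nlinarith [abs_nonneg (f 0), hp x]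
  · refine ⟨|f 0| + ‖fderiv ℝ f 0‖ + 1, fun x => ?_⟩
    have h1 := hf.abs_sub_sub_fderiv_le hs1 hs2 x 0
    have h2 := (fderiv ℝ f 0).le_opNorm x
    have h3 := norm_le_one_add_rpow hs1.le x
    simp only [sub_zero, norm_zero, add_zero] at h1
    rw [← Real.rpow_add_one' (norm_nonneg x) (by linarith), sub_add_cancel] at h1
    have h4 : |f x| ≤ |f x - f 0 - fderiv ℝ f 0 x| + |f 0| + ‖fderiv ℝ f 0 x‖ := by
      rw [Real.norm_eq_abs]
      have : f x = (f x - f 0 - fderiv ℝ f 0 x) + f 0 + fderiv ℝ f 0 x := by ring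
      calc |f x| = |(f x - f 0 - fderiv ℝ f 0 x) + f 0 + fderiv ℝ f 0 x| := by rw [← this]
        _ ≤ _ := abs_add_three _ _ _
    have h5 : ‖fderiv ℝ f 0‖ * ‖x‖ ≤ ‖fderiv ℝ f 0‖ * (1 + ‖x‖ ^ s) := by gcongr
    nlinarith [abs_nonneg (f 0), hp x, norm_nonneg (fderiv ℝ f 0)]

theorem IsHolderSmooth.continuous {s C : ℝ} {f : E → ℝ} (hf : IsHolderSmooth s C f) :
    Continuous f := hf.1.continuous

end HolderSmooth

theorem sum_rpow_le_card_rpow_mul_sum {ι : Type*} (t : Finset ι) (x : ι → ℝ≥0∞) {s : ℝ}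
    (hs : 0 < s) : (∑ i ∈ t, x i) ^ s ≤ (t.card : ℝ≥0∞) ^ s * ∑ i ∈ t, x i ^ s := by
  rcases t.eq_empty_or_nonempty with rfl | ht
  · simp [hs]
  obtain ⟨j, hj, hmax⟩ := t.exists_max_image x ht
  calc (∑ i ∈ t, x i) ^ s ≤ (t.card * x j) ^ s := by
        gcongr
        simpa using Finset.sum_le_card_nsmul t x (x j) hmax
    _ = (t.card : ℝ≥0∞) ^ s * x j ^ s := ENNReal.mul_rpow_of_nonneg _ _ hs.le
    _ ≤ _ := by
        gcongr
        exact Finset.single_le_sum (f := fun i => x i ^ s) (fun _ _ => zero_le) hj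

theorem add_rpow_le_two_rpow_mul {s : ℝ} (hs : 0 < s) (x y : ℝ≥0∞) :
    (x + y) ^ s ≤ 2 ^ s * (x ^ s + y ^ s) := by
  simpa using sum_rpow_le_card_rpow_mul_sum Finset.univ ![x, y] hs

/-! ### The Zolotarev distance: coupling bounds, finiteness, separation -/

section Zolotarev

variable {H : Type*} [NormedAddCommGroup H] [NormedSpace ℝ H] [MeasurableSpace H] {s : ℝ}

theorem IsHolderSmooth.enorm_integral_sub_le {C : ℝ} (hC : 0 < C) {f : H → ℝ}
    (hf : IsHolderSmooth s C f) (μ ν : Measure H) :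
    ‖∫ x, f x ∂μ - ∫ x, f x ∂ν‖ₑ ≤ ENNReal.ofReal C * zolotarev s μ ν := by
  have h1 : (fun x => C⁻¹ * f x) ∈ testFunctions H s := by
    rw [← isHolderSmooth_one_iff]
    convert hf.const_mul C⁻¹ using 1
    rw [abs_of_pos (inv_pos.2 hC), inv_mul_cancel₀ hC.ne']
  have h2 : ENNReal.ofReal |∫ x, C⁻¹ * f x ∂μ - ∫ x, C⁻¹ * f x ∂ν| ≤ zolotarev s μ ν :=
    le_iSup₂ (f := fun f (_ : f ∈ testFunctions H s) =>
      ENNReal.ofReal |∫ x, f x ∂μ - ∫ x, f x ∂ν|) _ h1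
  rw [integral_const_mul, integral_const_mul, ← mul_sub, abs_mul, abs_of_pos (inv_pos.2 hC)] at h2
  calc ‖∫ x, f x ∂μ - ∫ x, f x ∂ν‖ₑ
      = ENNReal.ofReal C * ENNReal.ofReal (C⁻¹ * |∫ x, f x ∂μ - ∫ x, f x ∂ν|) := by
        rw [← ENNReal.ofReal_mul hC.le, mul_inv_cancel_left₀ hC.ne', Real.enorm_eq_ofReal_abs]
    _ ≤ _ := by gcongr

theorem zolotarev_le {μ ν : Measure H} {c : ℝ≥0∞}
    (h : ∀ f : H → ℝ, IsHolderSmooth s 1 f → ‖∫ x, f x ∂μ - ∫ x, f x ∂ν‖ₑ ≤ c) :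
    zolotarev s μ ν ≤ c := by
  refine iSup₂_le fun f hf => ?_
  rw [← Real.enorm_eq_ofReal_abs]
  exact h f (isHolderSmooth_one_iff.2 hf)

theorem enorm_integral_comp_affine_sub_le (hs : 0 < s) {f : H → ℝ} (hf : IsHolderSmooth s 1 f)
    (a : H →L[ℝ] H) (c : H) (μ ν : Measure H) [IsProbabilityMeasure μ] [IsProbabilityMeasure ν] :
    ‖∫ x, f (c + a x) ∂μ - ∫ x, f (c + a x) ∂ν‖ₑ ≤ ‖a‖ₑ ^ s * zolotarev s μ ν := by
  rcases eq_or_ne a 0 with rfl | ha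
  · simp
  have ha : 0 < ‖a‖ := norm_pos_iff.2 ha
  have h := (hf.comp_affine hs zero_le_one a c).enorm_integral_sub_le (by positivity) μ ν
  rwa [one_mul, ← ENNReal.ofReal_rpow_of_pos ha, ofReal_norm] at h

variable [BorelSpace H] [SecondCountableTopology H]

theorem integrable_norm_rpow {α : Type*} [MeasurableSpace α] {Q : Measure α} {U : α → H}
    (hU : AEMeasurable U Q) (hs : 0 ≤ s) (h : ∫⁻ ω, ‖U ω‖ₑ ^ s ∂Q < ∞) :
    Integrable (fun ω => ‖U ω‖ ^ s) Q := by
  refine ⟨(hU.norm.pow_const s).aestronglyMeasurable, ?_⟩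
  rw [hasFiniteIntegral_iff_enorm]
  convert h using 3 with ω
  rw [Real.enorm_rpow_of_nonneg (norm_nonneg _) hs, enorm_norm]

theorem integrable_of_one_le {α : Type*} [MeasurableSpace α] {Q : Measure α} [IsFiniteMeasure Q]
    {U : α → H} (hU : AEMeasurable U Q) (hs : 1 ≤ s) (h : ∫⁻ ω, ‖U ω‖ₑ ^ s ∂Q < ∞) :
    Integrable U Q :=
  Integrable.mono' ((integrable_const 1).add (integrable_norm_rpow hU (by linarith) h))
    hU.aestronglyMeasurable (ae_of_all _ fun ω => norm_le_one_add_rpow hs (U ω))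

theorem IsHolderSmooth.integrable_comp (hs : 0 < s) (hs2 : s ≤ 2) {f : H → ℝ}
    (hf : IsHolderSmooth s 1 f) {α : Type*} [MeasurableSpace α] {Q : Measure α}
    [IsFiniteMeasure Q] {U : α → H} (hU : AEMeasurable U Q) (h : ∫⁻ ω, ‖U ω‖ₑ ^ s ∂Q < ∞) :
    Integrable (fun ω => f (U ω)) Q := by
  obtain ⟨C, hC⟩ := hf.exists_abs_le hs2
  exact Integrable.mono' (((integrable_const 1).add (integrable_norm_rpow hU hs.le h)).const_mul C)
    (hf.continuous.measurable.comp_aemeasurable hU).aestronglyMeasurable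
    (ae_of_all _ fun ω => hC (U ω))

section Coupling

variable {α : Type*} [MeasurableSpace α] {Q : Measure α} [IsProbabilityMeasure Q] {U V : α → H}

theorem lintegral_enorm_sub_rpow_lt_top (hs : 0 < s) (hV : Measurable V)
    (h1 : ∫⁻ ω, ‖U ω‖ₑ ^ s ∂Q < ∞) (h2 : ∫⁻ ω, ‖V ω‖ₑ ^ s ∂Q < ∞) :
    ∫⁻ ω, ‖U ω - V ω‖ₑ ^ s ∂Q < ∞ := by
  calc ∫⁻ ω, ‖U ω - V ω‖ₑ ^ s ∂Q ≤ ∫⁻ ω, 2 ^ s * (‖U ω‖ₑ ^ s + ‖V ω‖ₑ ^ s) ∂Q := by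
        refine lintegral_mono fun ω => le_trans ?_ (add_rpow_le_two_rpow_mul hs _ _)
        gcongr
        exact enorm_sub_le
    _ = 2 ^ s * (∫⁻ ω, ‖U ω‖ₑ ^ s ∂Q + ∫⁻ ω, ‖V ω‖ₑ ^ s ∂Q) := by
        rw [lintegral_const_mul' _ _ (by finiteness), lintegral_add_right _ (by fun_prop)]
    _ < ∞ := by finiteness

theorem lintegral_enorm_rpow_lt_top_of_sub (hs : 0 < s) (hV : Measurable V)
    (h1 : ∫⁻ ω, ‖U ω - V ω‖ₑ ^ s ∂Q < ∞) (h2 : ∫⁻ ω, ‖V ω‖ₑ ^ s ∂Q < ∞) :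
    ∫⁻ ω, ‖U ω‖ₑ ^ s ∂Q < ∞ := by
  have := lintegral_enorm_sub_rpow_lt_top (U := fun ω => U ω - V ω) (V := fun ω => - V ω) (Q := Q)
    hs hV.neg h1 (by simpa using h2)
  simpa using this

theorem zolotarev_map_le_of_le_one (hs : 0 < s) (hs1 : s ≤ 1) (hU : Measurable U)
    (hV : Measurable V) (hUs : ∫⁻ ω, ‖U ω‖ₑ ^ s ∂Q < ∞) (hVs : ∫⁻ ω, ‖V ω‖ₑ ^ s ∂Q < ∞) :
    zolotarev s (Q.map U) (Q.map V) ≤ ∫⁻ ω, ‖U ω - V ω‖ₑ ^ s ∂Q := by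
  refine zolotarev_le fun f hf => ?_
  have hfU := hf.integrable_comp hs (by linarith) hU.aemeasurable hUs
  have hfV := hf.integrable_comp hs (by linarith) hV.aemeasurable hVs
  rw [integral_map hU.aemeasurable hf.continuous.measurable.aestronglyMeasurable,
    integral_map hV.aemeasurable hf.continuous.measurable.aestronglyMeasurable,
    ← integral_sub hfU hfV]
  refine (enorm_integral_le_lintegral_enorm _).trans (lintegral_mono fun ω => ?_)
  have h := ((isHolderSmooth_iff_of_le_one hs1).1 hf).2 (U ω) (V ω)
  rw [Real.enorm_eq_ofReal_abs, ← ofReal_norm,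
    ENNReal.ofReal_rpow_of_nonneg (norm_nonneg _) hs.le]
  exact ENNReal.ofReal_le_ofReal (by simpa using h)

/-- Since the means agree, the linear term `Df(0)(U - V)` may be subtracted for free. The Taylor
estimate leaves `(‖U‖ + ‖V‖) ^ (s - 1) * ‖U - V‖`, to which Hölder's inequality with exponents `s /
(s - 1)` and `s` applies. -/
theorem zolotarev_map_le_of_one_lt [CompleteSpace H] (hs : 1 < s) (hs2 : s ≤ 2) (hU : Measurable U)
    (hV : Measurable V) (hUs : ∫⁻ ω, ‖U ω‖ₑ ^ s ∂Q < ∞) (hVs : ∫⁻ ω, ‖V ω‖ₑ ^ s ∂Q < ∞)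
    (hUV : ∫ ω, U ω ∂Q = ∫ ω, V ω ∂Q) :
    zolotarev s (Q.map U) (Q.map V) ≤
      (2 ^ s * (∫⁻ ω, ‖U ω - V ω‖ₑ ^ s ∂Q + 2 ^ s * ∫⁻ ω, ‖V ω‖ₑ ^ s ∂Q)) ^ ((s - 1) / s) *
        (∫⁻ ω, ‖U ω - V ω‖ₑ ^ s ∂Q) ^ (1 / s) := by
  have hs0 : 0 < s := by linarith
  have hint : zolotarev s (Q.map U) (Q.map V)
      ≤ ∫⁻ ω, (‖U ω‖ₑ + ‖V ω‖ₑ) ^ (s - 1) * ‖U ω - V ω‖ₑ ∂Q := by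
    refine zolotarev_le fun f hf => ?_
    have hfU := hf.integrable_comp hs0 hs2 hU.aemeasurable hUs
    have hfV := hf.integrable_comp hs0 hs2 hV.aemeasurable hVs
    have hUi := integrable_of_one_le hU.aemeasurable hs.le hUs
    have hVi := integrable_of_one_le hV.aemeasurable hs.le hVs
    have h0 : ∫ ω, fderiv ℝ f 0 (U ω - V ω) ∂Q = 0 := by
      have := (fderiv ℝ f 0).integral_comp_comm (hUi.sub hVi)
      rwa [integral_sub' hUi hVi, hUV, sub_self, map_zero] at this
    have hi : Integrable (fun ω => fderiv ℝ f 0 (U ω - V ω)) Q :=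
      (fderiv ℝ f 0).integrable_comp (hUi.sub hVi)
    rw [integral_map hU.aemeasurable hf.continuous.measurable.aestronglyMeasurable,
      integral_map hV.aemeasurable hf.continuous.measurable.aestronglyMeasurable,
      ← integral_sub hfU hfV, ← sub_zero (∫ ω, _ ∂Q), ← h0]
    have := integral_sub (hfU.sub hfV) hi
    simp only [Pi.sub_apply] at this
    rw [← this]
    refine (enorm_integral_le_lintegral_enorm _).trans (lintegral_mono fun ω => ?_)
    have h := hf.abs_sub_sub_fderiv_le hs hs2 (U ω) (V ω)
    rw [Real.enorm_eq_ofReal_abs]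
    refine (ENNReal.ofReal_le_ofReal h).trans_eq ?_
    rw [ENNReal.ofReal_mul (by positivity), ← ENNReal.ofReal_rpow_of_nonneg (by positivity)
      (by linarith), ENNReal.ofReal_add (norm_nonneg _) (norm_nonneg _)]
    simp only [ofReal_norm]
  refine hint.trans ?_
  have hpq : (s / (s - 1)).HolderConjugate s :=
    (Real.HolderConjugate.conjExponent hs).symm
  refine (ENNReal.lintegral_mul_le_Lp_mul_Lq Q hpq (by fun_prop) (by fun_prop)).trans ?_
  have hexp : (s - 1) * (s / (s - 1)) = s := by
    field_simp [sub_ne_zero.2 hs.ne']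
  simp only [← ENNReal.rpow_mul, hexp, one_div_div]
  gcongr
  -- `‖U‖ + ‖V‖ ≤ ‖U - V‖ + 2‖V‖`: the bound involves no moment of `U` itself, so it stays uniform
  -- when `U` varies and tends to `V`.
  calc ∫⁻ ω, (‖U ω‖ₑ + ‖V ω‖ₑ) ^ s ∂Q
      ≤ ∫⁻ ω, 2 ^ s * (‖U ω - V ω‖ₑ ^ s + 2 ^ s * ‖V ω‖ₑ ^ s) ∂Q := by
        refine lintegral_mono fun ω => ?_
        rw [← ENNReal.mul_rpow_of_nonneg _ _ hs0.le]
        refine le_trans ?_ (add_rpow_le_two_rpow_mul hs0 _ _)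
        refine ENNReal.rpow_le_rpow ?_ hs0.le
        rw [two_mul, ← add_assoc]
        refine add_le_add_left ?_ _
        simpa using enorm_add_le (U ω - V ω) (V ω)
    _ = _ := by
        rw [lintegral_const_mul' _ _ (by finiteness), lintegral_add_right _ (by fun_prop),
          lintegral_const_mul' _ _ (by finiteness)]

theorem tendsto_zolotarev_map [CompleteSpace H] (hs : 0 < s) (hs2 : s ≤ 2) {U : ℕ → α → H}
    (hU : ∀ᶠ n in atTop, Measurable (U n)) (hV : Measurable V)
    (hVs : ∫⁻ ω, ‖V ω‖ₑ ^ s ∂Q < ∞)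
    (hUV : 1 < s → ∀ᶠ n in atTop, ∫ ω, U n ω ∂Q = ∫ ω, V ω ∂Q)
    (h : Tendsto (fun n => ∫⁻ ω, ‖U n ω - V ω‖ₑ ^ s ∂Q) atTop (𝓝 0)) :
    Tendsto (fun n => zolotarev s (Q.map (U n)) (Q.map V)) atTop (𝓝 0) := by
  have h1 := h.eventually (gt_mem_nhds zero_lt_one)
  rcases le_or_gt s 1 with hs1 | hs1
  · refine tendsto_of_tendsto_of_tendsto_of_le_of_le' tendsto_const_nhds h
      (Eventually.of_forall fun _ => zero_le) ?_
    filter_upwards [hU, h1] with n hn h1n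
    exact zolotarev_map_le_of_le_one hs hs1 hn hV
      (lintegral_enorm_rpow_lt_top_of_sub hs hV (h1n.trans ENNReal.one_lt_top) hVs) hVs
  · set M := ∫⁻ ω, ‖V ω‖ₑ ^ s ∂Q
    -- The first factor of the coupling bound, once the `s`-th moment of `U n - V` is below `1`.
    set K := (2 ^ s * (1 + 2 ^ s * M)) ^ ((s - 1) / s)
    have hK : K ≠ ∞ :=
      ENNReal.rpow_ne_top_of_nonneg (div_nonneg (by linarith) hs.le) (by finiteness)
    have hlim : Tendsto (fun n => K * (∫⁻ ω, ‖U n ω - V ω‖ₑ ^ s ∂Q) ^ (1 / s)) atTop (𝓝 0) := by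
      have := ENNReal.Tendsto.const_mul (a := K)
        ((ENNReal.continuous_rpow_const (y := 1 / s)).continuousAt.tendsto.comp h) (Or.inr hK)
      simpa [hs] using this
    refine tendsto_of_tendsto_of_tendsto_of_le_of_le' tendsto_const_nhds hlim
      (Eventually.of_forall fun _ => zero_le) ?_
    filter_upwards [hU, h1, hUV hs1] with n hn h1n hm
    refine (zolotarev_map_le_of_one_lt hs1 hs2 hn hV
      (lintegral_enorm_rpow_lt_top_of_sub hs hV (h1n.trans ENNReal.one_lt_top) hVs) hVs hm).trans ?_
    have : 0 ≤ (s - 1) / s := div_nonneg (by linarith) hs.le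
    exact mul_le_mul_left (ENNReal.rpow_le_rpow (by gcongr) this) _

end Coupling

/-- The coupling bounds are applied to the independent coupling, that is, to the two projections of
the product space. -/
theorem zolotarev_lt_top [CompleteSpace H] (hs : 0 < s) (hs2 : s ≤ 2) {μ ν : Measure H} (hμ : μ ∈ Ps H s)
    (hν : ν ∈ Ps H s) (hμν : 1 < s → ∫ x, x ∂μ = ∫ x, x ∂ν) : zolotarev s μ ν < ∞ := by
  have := hμ.1
  have := hν.1
  have e1 : (μ.prod ν).map Prod.fst = μ := by simp
  have e2 : (μ.prod ν).map Prod.snd = ν := by simp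
  have h1 : ∫⁻ p, ‖p.1‖ₑ ^ s ∂(μ.prod ν) < ∞ := by
    have : ∫⁻ p, ‖p.1‖ₑ ^ s ∂(μ.prod ν) = ∫⁻ x, ‖x‖ₑ ^ s ∂μ := by
      conv_rhs => rw [← e1]
      rw [lintegral_map (by fun_prop) (by fun_prop)]
    rw [this]; exact hμ.2
  have h2 : ∫⁻ p, ‖p.2‖ₑ ^ s ∂(μ.prod ν) < ∞ := by
    have : ∫⁻ p, ‖p.2‖ₑ ^ s ∂(μ.prod ν) = ∫⁻ x, ‖x‖ₑ ^ s ∂ν := by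
      conv_rhs => rw [← e2]
      rw [lintegral_map (by fun_prop) (by fun_prop)]
    rw [this]; exact hν.2
  have h3 := lintegral_enorm_sub_rpow_lt_top hs measurable_snd h1 h2
  suffices zolotarev s ((μ.prod ν).map Prod.fst) ((μ.prod ν).map Prod.snd) < ∞ by
    rwa [e1, e2] at this
  rcases le_or_gt s 1 with hs1 | hs1
  · exact (zolotarev_map_le_of_le_one hs hs1 measurable_fst measurable_snd h1 h2).trans_lt h3
  · refine (zolotarev_map_le_of_one_lt hs1 hs2 measurable_fst measurable_snd h1 h2 ?_).trans_lt ?_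
    · have h4 := integral_fun_fst (μ := μ) (ν := ν) (f := (id : H → H))
      have h5 := integral_fun_snd (μ := μ) (ν := ν) (f := (id : H → H))
      simp only [id, probReal_univ, one_smul] at h4 h5
      rw [h4, h5, hμν hs1]
    · exact ENNReal.mul_lt_top (ENNReal.rpow_lt_top_of_nonneg (div_nonneg (by linarith) hs.le)
        (by finiteness)) (ENNReal.rpow_lt_top_of_nonneg (by positivity) h3.ne)

section Separation

/-- Bounded Lipschitz functions are Hölder of every order `p ∈ [0, 1]`: the Lipschitz bound serves
at distances up to `1`, the sup bound beyond. This is used for `cos` if `s ≤ 1`, and for `sin` in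
the derivative otherwise. -/
theorem isHolderSmooth_cos {s : ℝ} (hs : 0 < s) (hs2 : s ≤ 2) (L : H →L[ℝ] ℝ) (c : ℝ) :
    ∃ C > 0, IsHolderSmooth s C fun x => Real.cos (L x + c) := by
  have hmin : ∀ g : ℝ → ℝ, (∀ x, |g x| ≤ 1) → (∀ x y, |g x - g y| ≤ |x - y|) → ∀ p : ℝ, 0 ≤ p → p ≤ 1 →
      ∀ x y : H, |g (L x + c) - g (L y + c)| ≤ (2 + ‖L‖) * ‖x - y‖ ^ p := by
    intro g hg1 hg2 p hp0 hp1 x y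
    have h1 : |g (L x + c) - g (L y + c)| ≤ 2 :=
      (abs_sub _ _).trans (by linarith [hg1 (L x + c), hg1 (L y + c)])
    have h2 : |g (L x + c) - g (L y + c)| ≤ ‖L‖ * ‖x - y‖ := by
      refine (hg2 _ _).trans ?_
      rw [add_sub_add_right_eq_sub, ← map_sub]
      exact L.le_opNorm _
    rcases le_total ‖x - y‖ 1 with h | h
    · have : ‖x - y‖ ≤ ‖x - y‖ ^ p := by
        rcases (norm_nonneg (x - y)).eq_or_lt with h0 | h0
        · rw [← h0]; exact Real.rpow_nonneg le_rfl _
        · simpa using Real.rpow_le_rpow_of_exponent_ge h0 h hp1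
      nlinarith [norm_nonneg L, norm_nonneg (x - y), mul_le_mul_of_nonneg_left this (norm_nonneg L)]
    · have : 1 ≤ ‖x - y‖ ^ p := Real.one_le_rpow h hp0
      nlinarith [norm_nonneg L]
  rcases le_or_gt s 1 with hs1 | hs1
  · refine ⟨2 + ‖L‖, by positivity, (isHolderSmooth_iff_of_le_one hs1).2 ⟨by fun_prop, ?_⟩⟩
    exact hmin Real.cos Real.abs_cos_le_one Real.abs_cos_sub_cos_le s hs.le hs1
  · have hd : ∀ x, fderiv ℝ (fun x => Real.cos (L x + c)) x = -Real.sin (L x + c) • L := fun x =>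
      ((L.hasFDerivAt.add_const c).cos).fderiv
    refine ⟨(2 + ‖L‖) * (1 + ‖L‖), by positivity,
      (isHolderSmooth_iff_of_one_lt hs1 hs2).2 ⟨by fun_prop, fun x y => ?_⟩⟩
    rw [hd, hd, ← sub_smul, norm_smul, Real.norm_eq_abs, neg_sub_neg, abs_sub_comm]
    have := hmin Real.sin Real.abs_sin_le_one Real.abs_sin_sub_sin_le (s - 1) (by linarith)
      (by linarith) x y
    calc _ ≤ ((2 + ‖L‖) * ‖x - y‖ ^ (s - 1)) * (1 + ‖L‖) := by gcongr; linarith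
      _ = _ := by ring

theorem eq_of_zolotarev_eq_zero [CompleteSpace H] (hs : 0 < s) (hs2 : s ≤ 2) {μ ν : Measure H}
    [IsProbabilityMeasure μ] [IsProbabilityMeasure ν] (h : zolotarev s μ ν = 0) : μ = ν := by
  have hcos : ∀ (L : H →L[ℝ] ℝ) (c : ℝ),
      ∫ x, Real.cos (L x + c) ∂μ = ∫ x, Real.cos (L x + c) ∂ν := by
    intro L c
    obtain ⟨C, hC, hf⟩ := isHolderSmooth_cos hs hs2 L c
    have := hf.enorm_integral_sub_le hC μ ν
    rw [h, mul_zero, nonpos_iff_eq_zero, enorm_eq_zero, sub_eq_zero] at this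
    exact this
  -- The phases `0` and `-π/2` yield the real and imaginary parts of the characteristic functional,
  -- which determines the law.
  have hre : ∀ (ρ : Measure H) [IsProbabilityMeasure ρ] (L : StrongDual ℝ H),
      charFunDual ρ L = (∫ x, Real.cos (L x + 0) ∂ρ : ℝ)
        + (∫ x, Real.cos (L x + -(Real.pi / 2)) ∂ρ : ℝ) * Complex.I := by
    intro ρ _ L
    have hi : Integrable (fun x => Complex.exp (L x * Complex.I)) ρ := by
      refine Integrable.of_bound (by fun_prop) 1 (ae_of_all _ fun x => ?_)
      rw [Complex.norm_exp_ofReal_mul_I]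
    rw [charFunDual_apply, ← integral_re_add_im hi]
    simp [Complex.exp_ofReal_mul_I_re, Complex.exp_ofReal_mul_I_im, ← sub_eq_add_neg, Real.cos_sub_pi_div_two]
  refine Measure.ext_of_charFunDual ?_
  ext L
  rw [hre, hre, hcos, hcos]

end Separation

end Zolotarev

/-! ### Control of the `s`-th moment by `ζ_s` in a Hilbert space -/

section Moment

variable {H : Type*} [NormedAddCommGroup H] [InnerProductSpace ℝ H] {s : ℝ}

/-- For `‖y‖ ≤ ‖x‖` and `p = ‖x‖ ^ (α - 1)`, the difference splits into `p (x - y)` and a multiple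
of `y`, each of norm at most `p ‖x - y‖`. Since `‖x - y‖ ≤ 2‖x‖` and `α - 1 ≤ 0`, `p` is at most
`(‖x - y‖ / 2) ^ (α - 1)`, whence the constant `2 * 2 ^ (1 - α) ≤ 4`. -/
theorem norm_rpow_smul_sub_le {α : ℝ} (hα0 : 0 < α) (hα1 : α ≤ 1) (x y : H) :
    ‖‖x‖ ^ (α - 1) • x - ‖y‖ ^ (α - 1) • y‖ ≤ 4 * ‖x - y‖ ^ α := by
  wlog hxy : ‖y‖ ≤ ‖x‖ generalizing x y
  · rw [norm_sub_rev, norm_sub_rev x]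
    exact this y x (le_of_not_ge hxy)
  have hmul : ∀ z : H, ‖z‖ ^ (α - 1) * ‖z‖ = ‖z‖ ^ α := fun z => by
    rw [← Real.rpow_add_one' (norm_nonneg z) (by linarith), sub_add_cancel]
  rcases (norm_nonneg x).eq_or_lt with hx | hx
  · rw [norm_eq_zero.1 hx.symm, norm_eq_zero.1 (le_antisymm (hxy.trans hx.symm.le) (norm_nonneg y))]
    simp [hα0.ne']
  set p := ‖x‖ ^ (α - 1)
  have hp : 0 ≤ p := by positivity
  have h1 : ‖(p - ‖y‖ ^ (α - 1)) • y‖ ≤ p * ‖x - y‖ := by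
    rcases (norm_nonneg y).eq_or_lt with hy | hy
    · rw [norm_smul, ← hy, mul_zero]; positivity
    have hle : p ≤ ‖y‖ ^ (α - 1) := Real.rpow_le_rpow_of_nonpos hy hxy (by linarith)
    have hα : ‖y‖ ^ α ≤ ‖x‖ ^ α := Real.rpow_le_rpow hy.le hxy hα0.le
    rw [norm_smul, Real.norm_eq_abs, abs_of_nonpos (by linarith), neg_sub, sub_mul, hmul]
    have h2 := norm_sub_norm_le x y
    have h3 := hmul x
    -- `‖y‖ ^ α - p‖y‖ ≤ ‖x‖ ^ α - p‖y‖ = p (‖x‖ - ‖y‖) ≤ p‖x - y‖`.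
    nlinarith [mul_le_mul_of_nonneg_left h2 hp]
  have h2 : ‖p • x - ‖y‖ ^ (α - 1) • y‖ ≤ 2 * (p * ‖x - y‖) := by
    have : p • x - ‖y‖ ^ (α - 1) • y = p • (x - y) + (p - ‖y‖ ^ (α - 1)) • y := by
      rw [smul_sub, sub_smul]; abel
    rw [this]
    refine (norm_add_le _ _).trans ?_
    rw [norm_smul p, Real.norm_of_nonneg hp]
    linarith
  refine h2.trans ?_
  rcases (norm_nonneg (x - y)).eq_or_lt with h0 | h0
  · rw [← h0]; simp [hα0.ne']
  have h3 : ‖x - y‖ / 2 ≤ ‖x‖ := by linarith [norm_sub_le x y]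
  have h4 : p ≤ (‖x - y‖ / 2) ^ (α - 1) :=
    Real.rpow_le_rpow_of_nonpos (by positivity) h3 (by linarith)
  have h5 : (‖x - y‖ / 2) ^ (α - 1) = ‖x - y‖ ^ (α - 1) * 2 ^ (1 - α) := by
    rw [Real.div_rpow h0.le (by norm_num), div_eq_mul_inv, ← Real.rpow_neg (by norm_num), neg_sub]
  have h6 : (2 : ℝ) ^ (1 - α) ≤ 2 := by
    simpa using Real.rpow_le_rpow_of_exponent_le (x := 2) (by norm_num) (by linarith : 1 - α ≤ 1)
  have h7 : (0 : ℝ) ≤ ‖x - y‖ ^ α := by positivity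
  calc 2 * (p * ‖x - y‖) ≤ 2 * (‖x - y‖ ^ (α - 1) * 2 ^ (1 - α) * ‖x - y‖) := by
        rw [← h5]; gcongr
    _ = 2 * 2 ^ (1 - α) * ‖x - y‖ ^ α := by rw [← hmul]; ring
    _ ≤ 4 * ‖x - y‖ ^ α := by nlinarith

/-- For `s > 1` the gradient is `s ‖x‖ ^ (s - 2) x`, so the preceding estimate with `α = s - 1`
gives the constant `4 s ≤ 8`. For `s ≤ 1`, subadditivity of `t ↦ t ^ s` suffices. The inner product
enters through this gradient formula. -/
theorem isHolderSmooth_norm_rpow (hs : 0 < s) (hs2 : s ≤ 2) :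
    IsHolderSmooth s 8 fun x : H => ‖x‖ ^ s := by
  rcases le_or_gt s 1 with hs1 | hs1
  · refine (isHolderSmooth_iff_of_le_one hs1).2
      ⟨continuous_norm.rpow_const fun _ => Or.inr hs.le, fun x y => ?_⟩
    wlog hxy : ‖y‖ ≤ ‖x‖ generalizing x y
    · rw [abs_sub_comm, norm_sub_rev]
      exact this y x (le_of_not_ge hxy)
    have h1 : ‖x‖ ^ s ≤ ‖x - y‖ ^ s + ‖y‖ ^ s := by
      refine le_trans (Real.rpow_le_rpow (norm_nonneg x) ?_ hs.le)
        (Real.rpow_add_le_add_rpow (norm_nonneg _) (norm_nonneg _) hs.le hs1)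
      simpa using norm_add_le (x - y) y
    have h2 : 0 ≤ ‖x - y‖ ^ s := Real.rpow_nonneg (norm_nonneg _) _
    rw [abs_of_nonneg (sub_nonneg.2 (Real.rpow_le_rpow (norm_nonneg y) hxy hs.le))]
    linarith
  · refine (isHolderSmooth_iff_of_one_lt hs1 hs2).2 ⟨contDiff_norm_rpow hs1, fun x y => ?_⟩
    rw [fderiv_norm_rpow x hs1, fderiv_norm_rpow y hs1]
    have h := norm_rpow_smul_sub_le (sub_pos.2 hs1) (by linarith) x y
    have e : (s * ‖x‖ ^ (s - 2)) • innerSL ℝ x - (s * ‖y‖ ^ (s - 2)) • innerSL ℝ y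
        = s • innerSL ℝ (‖x‖ ^ (s - 1 - 1) • x - ‖y‖ ^ (s - 1 - 1) • y) := by
      rw [map_sub, map_smul, map_smul, smul_sub, smul_smul, smul_smul]
      norm_num [sub_sub]
    rw [e, norm_smul, innerSL_apply_norm, Real.norm_of_nonneg hs.le]
    have h7 : (0 : ℝ) ≤ ‖x - y‖ ^ (s - 1) := by positivity
    nlinarith [norm_nonneg (‖x‖ ^ (s - 1 - 1) • x - ‖y‖ ^ (s - 1 - 1) • y)]

theorem lintegral_enorm_rpow_le_zolotarev [MeasurableSpace H] [BorelSpace H]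
    [SecondCountableTopology H]
    (hs : 0 < s) (hs2 : s ≤ 2) {μ : Measure H} (h : ∫⁻ x, ‖x‖ₑ ^ s ∂μ < ∞) :
    ∫⁻ x, ‖x‖ₑ ^ s ∂μ ≤ 8 * zolotarev s μ (Measure.dirac 0) := by
  have h1 := (isHolderSmooth_norm_rpow (H := H) hs hs2).enorm_integral_sub_le (by norm_num) μ
    (Measure.dirac 0)
  have h2 : ∫ x, ‖x‖ ^ s ∂(Measure.dirac (0 : H)) = 0 := by
    rw [integral_dirac' _ _ (by fun_prop (discharger := exact hs.le))]; simp [hs.ne']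
  have hi : Integrable (fun x : H => ‖x‖ ^ s) μ := integrable_norm_rpow aemeasurable_id hs.le h
  rw [h2, sub_zero, Real.enorm_of_nonneg (integral_nonneg fun x => by positivity),
    ofReal_integral_eq_lintegral_ofReal hi (ae_of_all _ fun x => by positivity)] at h1
  simpa [← ENNReal.ofReal_rpow_of_nonneg, hs.le] using h1

end Moment

/-! ### Independent summands under fixed operators -/

section Deterministic

variable {H : Type*} [NormedAddCommGroup H] [NormedSpace ℝ H] [MeasurableSpace H]
  [BorelSpace H] [SecondCountableTopology H] {s : ℝ}

theorem lintegral_enorm_sum_add_rpow_le {α : Type*} [MeasurableSpace α] {Q : Measure α} {m : ℕ}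
    (hs : 0 < s) {Z : Fin m → α → H} (hZ : ∀ r, Measurable (Z r)) (b : α → H) :
    ∫⁻ ω, ‖∑ r, Z r ω + b ω‖ₑ ^ s ∂Q ≤
      2 ^ s * (m ^ s * ∑ r, ∫⁻ ω, ‖Z r ω‖ₑ ^ s ∂Q + ∫⁻ ω, ‖b ω‖ₑ ^ s ∂Q) := by
  have hms : (m : ℝ≥0∞) ^ s ≠ ∞ := by finiteness
  calc ∫⁻ ω, ‖∑ r, Z r ω + b ω‖ₑ ^ s ∂Q
      ≤ ∫⁻ ω, 2 ^ s * (m ^ s * ∑ r, ‖Z r ω‖ₑ ^ s + ‖b ω‖ₑ ^ s) ∂Q := by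
        refine lintegral_mono fun ω => ?_
        calc ‖∑ r, Z r ω + b ω‖ₑ ^ s ≤ (∑ r, ‖Z r ω‖ₑ + ‖b ω‖ₑ) ^ s := by
              gcongr
              exact (enorm_add_le _ _).trans (by gcongr; exact enorm_sum_le _ _)
          _ ≤ 2 ^ s * ((∑ r, ‖Z r ω‖ₑ) ^ s + ‖b ω‖ₑ ^ s) := add_rpow_le_two_rpow_mul hs _ _
          _ ≤ _ := by
              gcongr
              simpa using sum_rpow_le_card_rpow_mul_sum Finset.univ (fun r => ‖Z r ω‖ₑ) hs
    _ = _ := by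
        rw [lintegral_const_mul' _ _ (by finiteness), lintegral_add_left (by fun_prop),
          lintegral_const_mul' _ _ hms, lintegral_finsetSum _ fun r _ => by fun_prop]

theorem lintegral_eval_pi {m : ℕ} {μ : Fin m → Measure H} [∀ r, IsProbabilityMeasure (μ r)]
    (r : Fin m) {g : H → ℝ≥0∞} (hg : Measurable g) :
    ∫⁻ x, g (x r) ∂Measure.pi μ = ∫⁻ x, g x ∂μ r := by
  rw [← (measurePreserving_eval μ r).lintegral_comp hg]

theorem lintegral_sum_add_rpow_pi_lt_top {m : ℕ} (hs : 0 < s) (a : Fin m → H →L[ℝ] H) (c : H)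
    {μ : Fin m → Measure H} (hμ : ∀ r, μ r ∈ Ps H s) :
    ∫⁻ x, ‖∑ r, a r (x r) + c‖ₑ ^ s ∂Measure.pi μ < ∞ := by
  have := fun r => (hμ r).1
  refine (lintegral_enorm_sum_add_rpow_le hs (Z := fun r (x : Fin m → H) => a r (x r))
    (fun r => by fun_prop) fun _ => c).trans_lt ?_
  have h : ∀ r, ∫⁻ x, ‖a r (x r)‖ₑ ^ s ∂Measure.pi μ < ∞ := fun r => by
    rw [lintegral_eval_pi r (g := fun x => ‖a r x‖ₑ ^ s) (by fun_prop)]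
    calc ∫⁻ x, ‖a r x‖ₑ ^ s ∂μ r ≤ ∫⁻ x, ‖a r‖ₑ ^ s * ‖x‖ₑ ^ s ∂μ r := by
          refine lintegral_mono fun x => ?_
          rw [← ENNReal.mul_rpow_of_nonneg _ _ hs.le]
          gcongr
          exact (a r).le_opENorm x
      _ = ‖a r‖ₑ ^ s * ∫⁻ x, ‖x‖ₑ ^ s ∂μ r := lintegral_const_mul' _ _ (by finiteness)
      _ < ∞ := ENNReal.mul_lt_top (by finiteness) (hμ r).2
  have h' := ENNReal.sum_lt_top.2 fun r (_ : r ∈ Finset.univ) => h r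
  simp only [lintegral_const, measure_univ, mul_one]
  finiteness

theorem integrable_sum_add_pi {m : ℕ} (hs : 0 < s) (hs2 : s ≤ 2) {f : H → ℝ}
    (hf : IsHolderSmooth s 1 f) (a : Fin m → H →L[ℝ] H) (c : H)
    {μ : Fin m → Measure H} (hμ : ∀ r, μ r ∈ Ps H s) :
    Integrable (fun x => f (∑ r, a r (x r) + c)) (Measure.pi μ) := by
  have := fun r => (hμ r).1
  have hmeas : Measurable fun x : Fin m → H => ∑ r, a r (x r) + c :=
    (Finset.measurable_sum _ fun r _ => by fun_prop).add_const c
  exact hf.integrable_comp hs hs2 hmeas.aemeasurable (lintegral_sum_add_rpow_pi_lt_top hs a c hμ)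

theorem enorm_integral_sub_le_lintegral {α E : Type*} [MeasurableSpace α] {Q : Measure α}
    [NormedAddCommGroup E] [NormedSpace ℝ E] {φ ψ : α → E} (hφ : Integrable φ Q)
    (hψ : Integrable ψ Q) {g : α → ℝ≥0∞} (h : ∀ ω, ‖φ ω - ψ ω‖ₑ ≤ g ω) :
    ‖∫ ω, φ ω ∂Q - ∫ ω, ψ ω ∂Q‖ₑ ≤ ∫⁻ ω, g ω ∂Q := by
  rw [← integral_sub hφ hψ]
  exact (enorm_integral_le_lintegral_enorm _).trans (lintegral_mono h)

/-- Replacing the independent summands `a_r x_r` one at a time. -/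
theorem enorm_integral_pi_sub_le (hs : 0 < s) (hs2 : s ≤ 2) {f : H → ℝ}
    (hf : IsHolderSmooth s 1 f) {m : ℕ} (a : Fin m → H →L[ℝ] H) (c : H)
    {μ ν : Fin m → Measure H} (hμ : ∀ r, μ r ∈ Ps H s) (hν : ∀ r, ν r ∈ Ps H s) :
    ‖∫ x, f (∑ r, a r (x r) + c) ∂Measure.pi μ - ∫ x, f (∑ r, a r (x r) + c) ∂Measure.pi ν‖ₑ
      ≤ ∑ r, ‖a r‖ₑ ^ s * zolotarev s (μ r) (ν r) := by
  induction m generalizing c with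
  | zero =>
    have := fun r => (hμ r).1
    have := fun r => (hν r).1
    simp
  | succ m ih =>
    have split : ∀ {ρ : Fin (m + 1) → Measure H}, (∀ r, ρ r ∈ Ps H s) →
        Integrable (fun p : H × (Fin m → H) => f (∑ r : Fin m, a r.succ (p.2 r) + (a 0 p.1 + c)))
          ((ρ 0).prod (Measure.pi fun r => ρ r.succ)) ∧
        ∫ x, f (∑ r, a r (x r) + c) ∂Measure.pi ρ =
          ∫ p : H × (Fin m → H), f (∑ r : Fin m, a r.succ (p.2 r) + (a 0 p.1 + c))
            ∂((ρ 0).prod (Measure.pi fun r => ρ r.succ)) := by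
      intro ρ hρ
      have := fun r => (hρ r).1
      have mp := (measurePreserving_piFinSuccAbove ρ 0).symm
      have e : (fun p : H × (Fin m → H) => f (∑ r : Fin m, a r.succ (p.2 r) + (a 0 p.1 + c)))
          = (fun x => f (∑ r, a r (x r) + c)) ∘ (MeasurableEquiv.piFinSuccAbove (fun _ => H) 0).symm
          := by
        funext p
        simp only [Function.comp_apply, Fin.sum_univ_succ]
        congr 1
        simp [MeasurableEquiv.piFinSuccAbove]
        abel
      rw [e]
      exact ⟨mp.integrable_comp_of_integrable (integrable_sum_add_pi hs hs2 hf a c hρ),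
        (mp.integral_comp' _).symm⟩
    have := fun r => (hμ r).1
    have := fun r => (hν r).1
    -- the intermediate law has first marginal `μ 0` and the others from `ν`
    set ρ : Fin (m + 1) → Measure H := Fin.cons (μ 0) fun r => ν r.succ with hρdef
    have hρ : ∀ r, ρ r ∈ Ps H s := Fin.cases (hμ 0) fun r => hν r.succ
    obtain ⟨iμ, eμ⟩ := split hμ
    obtain ⟨iν, eν⟩ := split hν
    obtain ⟨iρ, -⟩ := split hρ
    simp only [hρdef, Fin.cons_zero, Fin.cons_succ] at iρ
    rw [eμ, eν, Fin.sum_univ_succ, add_comm (‖a 0‖ₑ ^ s * _)]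
    rw [← edist_eq_enorm_sub]
    refine (edist_triangle _ (∫ p : H × (Fin m → H),
      f (∑ r : Fin m, a r.succ (p.2 r) + (a 0 p.1 + c))
        ∂((μ 0).prod (Measure.pi fun r => ν r.succ))) _).trans ?_
    rw [edist_eq_enorm_sub, edist_eq_enorm_sub]
    refine add_le_add ?_ ?_
    -- With the coordinate `0` frozen at `x`, the term `a 0 x` joins the constant; this is why the
    -- induction generalizes `c`.
    · rw [integral_prod _ iμ, integral_prod _ iρ]
      refine (enorm_integral_sub_le_lintegral iμ.integral_prod_left iρ.integral_prod_left
        fun x => ih (fun r => a r.succ) (a 0 x + c) (fun r => hμ r.succ)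
          fun r => hν r.succ).trans_eq ?_
      simp
    -- With the other coordinates frozen, only the law of coordinate `0` changes, and homogeneity
    -- applies.
    · rw [integral_prod_symm _ iρ, integral_prod_symm _ iν]
      refine (enorm_integral_sub_le_lintegral iρ.integral_prod_right iν.integral_prod_right
        (g := fun _ => ‖a 0‖ₑ ^ s * zolotarev s (μ 0) (ν 0)) fun x => ?_).trans_eq ?_
      · have := enorm_integral_comp_affine_sub_le hs hf (a 0)
          (∑ r : Fin m, a r.succ (x r) + c) (μ 0) (ν 0)
        simpa only [add_assoc, add_comm c] using this
      · simp

theorem integral_sum_add_pi [CompleteSpace H] {m : ℕ} (a : Fin m → H →L[ℝ] H) (c : H)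
    {μ : Fin m → Measure H} [∀ r, IsProbabilityMeasure (μ r)]
    (hi : ∀ r, Integrable (fun x => x) (μ r)) (h0 : ∀ r, ∫ x, x ∂μ r = 0) :
    ∫ x, (∑ r, a r (x r) + c) ∂Measure.pi μ = c := by
  have hi' : ∀ r, Integrable (fun x : Fin m → H => x r) (Measure.pi μ) := fun r =>
    (measurePreserving_eval μ r).integrable_comp_of_integrable (hi r)
  have h1 : ∀ r, ∫ x : Fin m → H, x r ∂Measure.pi μ = 0 := fun r => by
    rw [← h0 r, ← (measurePreserving_eval μ r).map_eq,
      integral_map (measurable_pi_apply r).aemeasurable (by fun_prop)]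
  rw [integral_add (integrable_finsetSum _ fun r _ => (a r).integrable_comp (hi' r))
    (integrable_const _), integral_finsetSum _ fun r _ => (a r).integrable_comp (hi' r)]
  simp [fun r => (a r).integral_comp_comm (hi' r), h1]

end Deterministic

/-! ### Random operators and the contraction property of `T` -/

section RandomOperator

variable {H Ω : Type*} [NormedAddCommGroup H] [InnerProductSpace ℝ H] [MeasurableSpace H]
  [BorelSpace H] [SecondCountableTopology H] {mΩ : MeasurableSpace Ω} {s : ℝ}

theorem IsRandomOperator.measurable_apply {A : Ω → H →L[ℝ] H} (hA : IsRandomOperator A) :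
    Measurable fun p : Ω × H => A p.1 p.2 :=
  (measurable_uncurry_of_continuous_of_measurable (u := fun x ω => A ω x)
    (fun ω => (A ω).continuous) hA).comp measurable_swap

theorem IsRandomOperator.measurable_apply_comp {α : Type*} [MeasurableSpace α]
    {A : Ω → H →L[ℝ] H} (hA : IsRandomOperator A) {g : α → Ω} (hg : Measurable g) {Z : α → H}
    (hZ : Measurable Z) : Measurable fun p => A (g p) (Z p) :=
  hA.measurable_apply.comp (hg.prodMk hZ)

theorem IsRandomOperator.sub {A A' : Ω → H →L[ℝ] H} (hA : IsRandomOperator A)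
    (hA' : IsRandomOperator A') : IsRandomOperator fun ω => A ω - A' ω :=
  fun x => (hA x).sub (hA' x)

/-- By continuity of `A ω`, the bound `‖A ω x‖ ≤ c ‖x‖` needs to be checked only on a countable
dense set, so no measurability of `A` for the operator norm is required. -/
theorem IsRandomOperator.measurable_norm {A : Ω → H →L[ℝ] H} (hA : IsRandomOperator A) :
    Measurable fun ω => ‖A ω‖ := by
  refine measurable_of_Iic fun c => ?_
  rcases lt_or_ge c 0 with hc | hc
  · convert MeasurableSet.empty
    ext ω
    simpa using hc.trans_le (norm_nonneg _)
  have : (fun ω => ‖A ω‖) ⁻¹' Set.Iic c =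
      ⋂ x ∈ TopologicalSpace.denseSeq H '' Set.univ, {ω | ‖A ω x‖ ≤ c * ‖x‖} := by
    ext ω
    simp only [Set.mem_preimage, Set.mem_Iic, Set.image_univ, Set.mem_iInter, Set.mem_ofPred_eq]
    refine ⟨fun h x _ => (A ω).le_of_opNorm_le h x, fun h => ?_⟩
    refine (A ω).opNorm_le_bound hc fun x => ?_
    have hcl : IsClosed {x : H | ‖A ω x‖ ≤ c * ‖x‖} :=
      isClosed_le (by fun_prop) (by fun_prop)
    exact hcl.closure_subset_iff.2 h (TopologicalSpace.denseRange_denseSeq H x)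
  rw [this]
  exact MeasurableSet.biInter (Set.countable_univ.image _) fun x _ =>
    measurableSet_le (hA x).norm measurable_const

theorem IsRandomOperator.measurable_enorm {A : Ω → H →L[ℝ] H} (hA : IsRandomOperator A) :
    Measurable fun ω => ‖A ω‖ₑ := by
  simp only [← ofReal_norm]
  exact hA.measurable_norm.ennreal_ofReal

/-- The law of `∑ r, A_r (g_r(ω, y_r)) + b` for independent `y_r` with laws `Q_r`, which are also
independent of `ω`. -/
noncomputable def affineLaw {S : Type*} [MeasurableSpace S] {m : ℕ} (P : Measure Ω)
    (Q : Fin m → Measure S) (A : Fin m → Ω → H →L[ℝ] H) (b : Ω → H) (g : Fin m → Ω → S → H) :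
    Measure H :=
  (P.prod (Measure.pi Q)).map fun p => ∑ r, A r p.1 (g r p.1 (p.2 r)) + b p.1

theorem fixedPointMap_eq_affineLaw {m : ℕ} (P : Measure Ω) (A : Fin m → Ω → H →L[ℝ] H)
    (b : Ω → H) (μ : Measure H) :
    fixedPointMap P A b μ = affineLaw P (fun _ => μ) A b fun _ _ x => x := rfl

section AffineLaw

variable {S : Type*} [MeasurableSpace S] {m : ℕ} {P : Measure Ω} [IsProbabilityMeasure P]
  {Q : Fin m → Measure S} [∀ r, IsProbabilityMeasure (Q r)]
  {A : Fin m → Ω → H →L[ℝ] H} {b : Ω → H} {g : Fin m → Ω → S → H}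

theorem measurable_affine (hA : ∀ r, IsRandomOperator (A r)) (hb : Measurable b)
    (hg : ∀ r, Measurable fun p : Ω × S => g r p.1 p.2) :
    Measurable fun p : Ω × (Fin m → S) => ∑ r, A r p.1 (g r p.1 (p.2 r)) + b p.1 := by
  refine Measurable.add (Finset.measurable_sum _ fun r _ => ?_) (hb.comp measurable_fst)
  exact (hA r).measurable_apply_comp measurable_fst
    ((hg r).comp (measurable_fst.prodMk ((measurable_pi_apply r).comp measurable_snd)))

/-- Fubini: given the coefficients `ω`, the arguments of the operators are independent with laws `(Q
r).map (g r ω)`, so estimates for fixed operators can be integrated over `ω`. The maps `g` serve to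
treat both `T` (`g` returns the point) and the recurrence (`g` evaluates a sequence at a random
index). -/
theorem integral_affineLaw {E : Type*} [NormedAddCommGroup E] [NormedSpace ℝ E]
    (hA : ∀ r, IsRandomOperator (A r)) (hb : Measurable b)
    (hg : ∀ r, Measurable fun p : Ω × S => g r p.1 p.2)
    {f : H → E} (hf : Continuous f) (hi : Integrable f (affineLaw P Q A b g)) :
    Integrable (fun ω => ∫ x, f (∑ r, A r ω (x r) + b ω)
        ∂Measure.pi fun r => (Q r).map (g r ω)) P ∧
      ∫ x, f x ∂affineLaw P Q A b g = ∫ ω, ∫ x, f (∑ r, A r ω (x r) + b ω)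
        ∂(Measure.pi fun r => (Q r).map (g r ω)) ∂P := by
  have hmeas := measurable_affine hA hb hg
  have hgω : ∀ r ω, Measurable (g r ω) := fun r ω => (hg r).comp measurable_prodMk_left
  have hinner : ∀ ω, ∫ x, f (∑ r, A r ω (x r) + b ω) ∂(Measure.pi fun r => (Q r).map (g r ω))
      = ∫ y, f (∑ r, A r ω (g r ω (y r)) + b ω) ∂Measure.pi Q := fun ω => by
    have : ∀ r, IsProbabilityMeasure ((Q r).map (g r ω)) := fun r =>
      Measure.isProbabilityMeasure_map (hgω r ω).aemeasurable
    rw [← Measure.pi_map_pi fun r => (hgω r ω).aemeasurable, integral_map]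
    · exact (measurable_pi_lambda _ fun r =>
        (hgω r ω).comp (measurable_pi_apply r)).aemeasurable
    · exact (hf.comp (by fun_prop)).aestronglyMeasurable
  simp only [hinner]
  have hi' := hi.comp_measurable hmeas
  exact ⟨hi'.integral_prod_left, by
    rw [affineLaw, integral_map hmeas.aemeasurable hf.aestronglyMeasurable]
    exact integral_prod _ hi'⟩

end AffineLaw

section FixedPointMap

variable {m : ℕ} {P : Measure Ω} [IsProbabilityMeasure P]
  {A : Fin m → Ω → H →L[ℝ] H} {b : Ω → H} {μ ν : Measure H}

theorem lintegral_enorm_affine_rpow_le (hs : 0 < s) (hA : ∀ r, IsRandomOperator (A r))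
    [IsProbabilityMeasure μ] (hb : Measurable b) :
    ∫⁻ p, ‖∑ r, A r p.1 (p.2 r) + b p.1‖ₑ ^ s ∂(P.prod (Measure.pi fun _ : Fin m => μ)) ≤
      2 ^ s * (m ^ s * ∑ r, (∫⁻ ω, ‖A r ω‖ₑ ^ s ∂P) * ∫⁻ x, ‖x‖ₑ ^ s ∂μ
        + ∫⁻ ω, ‖b ω‖ₑ ^ s ∂P) := by
  refine (lintegral_enorm_sum_add_rpow_le hs (Z := fun r (p : Ω × (Fin m → H)) => A r p.1 (p.2 r))
    (fun r => (hA r).measurable_apply_comp measurable_fst (by fun_prop)) fun p => b p.1).trans ?_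
  gcongr with r
  · calc ∫⁻ p : Ω × (Fin m → H), ‖A r p.1 (p.2 r)‖ₑ ^ s ∂(P.prod (Measure.pi fun _ => μ))
        ≤ ∫⁻ p : Ω × (Fin m → H), ‖A r p.1‖ₑ ^ s * ‖p.2 r‖ₑ ^ s
            ∂(P.prod (Measure.pi fun _ => μ)) := by
          refine lintegral_mono fun p => ?_
          rw [← ENNReal.mul_rpow_of_nonneg _ _ hs.le]
          gcongr
          exact (A r p.1).le_opENorm _
      _ = _ := by
          rw [lintegral_prod_mul (f := fun ω => ‖A r ω‖ₑ ^ s)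
            (g := fun x : Fin m → H => ‖x r‖ₑ ^ s)
            ((hA r).measurable_enorm.pow_const s).aemeasurable
            (((measurable_pi_apply r).enorm.pow_const s).aemeasurable),
            lintegral_eval_pi (μ := fun _ => μ) r (g := fun x => ‖x‖ₑ ^ s) (by fun_prop)]
  · rw [lintegral_prod _ (by fun_prop)]
    simp

theorem fixedPointMap_mem_Ps (hs : 0 < s) (hA : ∀ r, IsRandomOperator (A r))
    (hAs : ∀ r, ∫⁻ ω, ‖A r ω‖ₑ ^ s ∂P < ∞) (hb : Measurable b) (hbs : ∫⁻ ω, ‖b ω‖ₑ ^ s ∂P < ∞)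
    (hμ : μ ∈ Ps H s) : fixedPointMap P A b μ ∈ Ps H s := by
  have := hμ.1
  have hmeas := measurable_affine (g := fun _ _ x => x) hA hb fun _ => measurable_snd
  refine ⟨Measure.isProbabilityMeasure_map hmeas.aemeasurable, ?_⟩
  rw [fixedPointMap, lintegral_map (by fun_prop) hmeas]
  refine (lintegral_enorm_affine_rpow_le hs hA hb).trans_lt ?_
  have h := ENNReal.sum_lt_top.2 fun r (_ : r ∈ Finset.univ) => ENNReal.mul_lt_top (hAs r) hμ.2
  finiteness

theorem integral_fixedPointMap [CompleteSpace H] (hs : 1 ≤ s) (hA : ∀ r, IsRandomOperator (A r))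
    (hAs : ∀ r, ∫⁻ ω, ‖A r ω‖ₑ ^ s ∂P < ∞) (hb : Measurable b) (hbs : ∫⁻ ω, ‖b ω‖ₑ ^ s ∂P < ∞)
    (hμ : μ ∈ Ps H s) (h0 : ∫ x, x ∂μ = 0) :
    ∫ x, x ∂fixedPointMap P A b μ = ∫ ω, b ω ∂P := by
  have := hμ.1
  have hT := fixedPointMap_mem_Ps (by linarith) hA hAs hb hbs hμ
  have := hT.1
  have hi := integrable_of_one_le (U := fun x : H => x) aemeasurable_id hs hT.2
  rw [fixedPointMap_eq_affineLaw] at hi ⊢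
  rw [(integral_affineLaw (f := fun x => x) hA hb (fun _ => measurable_snd) continuous_id hi).2]
  simp only [Measure.map_id']
  exact integral_congr_ae (ae_of_all _ fun ω => integral_sum_add_pi _ _
    (fun _ => integrable_of_one_le (U := fun x : H => x) aemeasurable_id hs hμ.2) fun _ => h0)

theorem zolotarev_fixedPointMap_le (hs : 0 < s) (hs2 : s ≤ 2) (hA : ∀ r, IsRandomOperator (A r))
    (hAs : ∀ r, ∫⁻ ω, ‖A r ω‖ₑ ^ s ∂P < ∞) (hb : Measurable b) (hbs : ∫⁻ ω, ‖b ω‖ₑ ^ s ∂P < ∞)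
    (hμ : μ ∈ Ps H s) (hν : ν ∈ Ps H s) :
    zolotarev s (fixedPointMap P A b μ) (fixedPointMap P A b ν)
      ≤ (∫⁻ ω, ∑ r, ‖A r ω‖ₑ ^ s ∂P) * zolotarev s μ ν := by
  have := hμ.1
  have := hν.1
  refine zolotarev_le fun f hf => ?_
  have key : ∀ {ρ : Measure H}, ρ ∈ Ps H s →
      Integrable (fun ω => ∫ x, f (∑ r, A r ω (x r) + b ω) ∂Measure.pi fun _ => ρ) P ∧
      ∫ x, f x ∂fixedPointMap P A b ρ = ∫ ω, ∫ x, f (∑ r, A r ω (x r) + b ω)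
        ∂(Measure.pi fun _ => ρ) ∂P := by
    intro ρ hρ
    have := hρ.1
    have hT := fixedPointMap_mem_Ps hs hA hAs hb hbs hρ
    have := hT.1
    have hi := hf.integrable_comp hs hs2 (U := fun x : H => x) aemeasurable_id hT.2
    rw [fixedPointMap_eq_affineLaw] at hi ⊢
    simpa only [Measure.map_id'] using
      integral_affineLaw hA hb (fun _ => measurable_snd) hf.continuous hi
  rw [(key hμ).2, (key hν).2]
  refine (enorm_integral_sub_le_lintegral (key hμ).1 (key hν).1 fun ω =>
    enorm_integral_pi_sub_le hs hs2 hf (fun r => A r ω) (b ω) (fun _ => hμ) fun _ => hν).trans_eq ?_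
  simp only [← Finset.sum_mul]
  exact lintegral_mul_const _ (Finset.measurable_sum _ fun r _ =>
    (hA r).measurable_enorm.pow_const s)

end FixedPointMap

end RandomOperator

/-! ### The tree of independent coefficients and its self-similarity -/

section Tree

variable {Ω : Type*} [MeasurableSpace Ω] {m : ℕ}

/-- Independent copies of the coefficients at the nodes of the infinite `m`-ary tree. -/
noncomputable def treeMeasure (m : ℕ) (P : Measure Ω) : Measure (List (Fin m) → Ω) :=
  Measure.infinitePi fun _ => P

instance (P : Measure Ω) [IsProbabilityMeasure P] : IsProbabilityMeasure (treeMeasure m P) :=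
  inferInstanceAs (IsProbabilityMeasure (Measure.infinitePi fun _ => P))

/-- The tree with a given root and given subtrees. -/
def graft (p : Ω × (Fin m → List (Fin m) → Ω)) : List (Fin m) → Ω
  | [] => p.1
  | r :: v => p.2 r v

theorem measurable_graft : Measurable (graft (Ω := Ω) (m := m)) := by
  refine measurable_pi_lambda _ fun v => ?_
  cases v with
  | nil => exact measurable_fst
  | cons r v => exact (by fun_prop : Measurable fun p : Ω × (Fin m → List (Fin m) → Ω) => p.2 r v)

theorem prod_list_eq (S : Finset (List (Fin m))) (f : List (Fin m) → ℝ≥0∞) :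
    ∏ v ∈ S, f v = (if [] ∈ S then f [] else 1) *
      ∏ r, ∏ v ∈ S.preimage (List.cons r) (List.cons_injective.injOn), f (r :: v) := by
  classical
  rw [← Finset.prod_filter_mul_prod_filter_not S (· = []), Finset.prod_filter,
    Finset.prod_ite_eq']
  congr 1
  rw [Finset.prod_sigma']
  refine (Finset.prod_bij (fun p _ => p.1 :: p.2) ?_ ?_ ?_ ?_).symm
  · rintro ⟨r, v⟩ h
    simpa using h
  · rintro ⟨r, v⟩ - ⟨r', v'⟩ - h
    simp only [List.cons.injEq] at h
    obtain ⟨rfl, rfl⟩ := h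
    rfl
  · rintro (_ | ⟨r, v⟩) h
    · simp at h
    · exact ⟨⟨r, v⟩, by simpa using h, rfl⟩
  · rintro ⟨r, v⟩ -
    rfl

/-- The grafted measure gives cylinders the product weights, since a node is either the root or lies
in exactly one subtree; these weights characterize the infinite product. -/
theorem map_graft_treeMeasure (P : Measure Ω) [IsProbabilityMeasure P] :
    (P.prod (Measure.pi fun _ : Fin m => treeMeasure m P)).map graft = treeMeasure m P := by
  refine Measure.eq_infinitePi _ fun S B hB => ?_
  have hpre : graft ⁻¹' (Set.pi (S : Set (List (Fin m))) B)
      = (if [] ∈ S then B [] else Set.univ) ×ˢ Set.univ.pi fun r =>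
        Set.pi (S.preimage (List.cons r) (List.cons_injective.injOn) : Finset (List (Fin m)))
          fun v => B (r :: v) := by
    ext p
    simp only [Set.mem_preimage, Set.mem_pi, Finset.mem_coe, Set.mem_prod, Set.mem_univ,
      Finset.mem_preimage, true_implies]
    constructor
    · intro h
      refine ⟨?_, fun r v hv => h (r :: v) hv⟩
      split_ifs with h0
      · exact h [] h0
      · trivial
    · rintro ⟨h1, h2⟩ (_ | ⟨r, v⟩) hv
      · simpa [hv, graft] using h1
      · exact h2 r v hv
  rw [Measure.map_apply measurable_graft (.pi S.countable_toSet fun v _ => hB v), hpre,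
    Measure.prod_prod, Measure.pi_pi, prod_list_eq]
  congr 1
  · split_ifs <;> simp
  · exact Finset.prod_congr rfl fun r _ => Measure.infinitePi_pi _ fun v _ => hB _

theorem measurePreserving_root_subtrees (P : Measure Ω) [IsProbabilityMeasure P] :
    MeasurePreserving (fun t : List (Fin m) → Ω => (t [], fun (r : Fin m) v => t (r :: v)))
      (treeMeasure m P) (P.prod (Measure.pi fun _ => treeMeasure m P)) := by
  have hm : Measurable fun t : List (Fin m) → Ω => (t [], fun (r : Fin m) v => t (r :: v)) := by
    fun_prop
  refine ⟨hm, ?_⟩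
  conv_lhs => rw [← map_graft_treeMeasure, Measure.map_map hm measurable_graft]
  exact Measure.map_id

theorem measurePreserving_subtree (P : Measure Ω) [IsProbabilityMeasure P] (r : Fin m) :
    MeasurePreserving (fun (t : List (Fin m) → Ω) v => t (r :: v))
      (treeMeasure m P) (treeMeasure m P) :=
  (measurePreserving_eval (fun _ : Fin m => treeMeasure m P) r).comp
    (measurePreserving_snd.comp (measurePreserving_root_subtrees P))

theorem measurePreserving_root (P : Measure Ω) [IsProbabilityMeasure P] :
    MeasurePreserving (fun t : List (Fin m) → Ω => t []) (treeMeasure m P) P :=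
  measurePreserving_fst.comp (measurePreserving_root_subtrees P)

end Tree

/-- Geometric decay of the `s`-th moments gives an `s`-integrable sum, for every `s > 0`. -/
theorem lintegral_tsum_rpow_lt_top {α : Type*} [MeasurableSpace α] {Q : Measure α}
    {u : ℕ → α → ℝ≥0∞} (hu : ∀ n, Measurable (u n)) {s : ℝ} (hs : 0 < s) {C ξ : ℝ≥0∞}
    (hC : C ≠ ∞) (hξ : ξ < 1) (h : ∀ n, ∫⁻ ω, u n ω ^ s ∂Q ≤ C * ξ ^ n) :
    ∫⁻ ω, (∑' n, u n ω) ^ s ∂Q < ∞ := by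
  -- The room between `ξ` and `ρ` makes `S = ∑ ρ⁻ⁿ u_n ^ s` integrable, and the room between `ρ` and
  -- `1` makes `u_n ≤ κ ^ n * S ^ (1 / s)` summable pointwise. Minkowski's inequality is avoided, so
  -- `s < 1` needs no separate treatment.
  obtain ⟨ρ, hρ1, hρ2⟩ := exists_between hξ
  have hρ0 : ρ ≠ 0 := (pos_of_gt hρ1).ne'
  have hρt : ρ ≠ ∞ := (hρ2.trans ENNReal.one_lt_top).ne
  set S : α → ℝ≥0∞ := fun ω => ∑' n, (ρ ^ n)⁻¹ * u n ω ^ s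
  have hS : ∫⁻ ω, S ω ∂Q < ∞ := by
    calc ∫⁻ ω, S ω ∂Q = ∑' n, ∫⁻ ω, (ρ ^ n)⁻¹ * u n ω ^ s ∂Q :=
          lintegral_tsum fun n => by fun_prop
      _ ≤ ∑' n, C * (ξ / ρ) ^ n := by
          refine ENNReal.tsum_le_tsum fun n => ?_
          rw [lintegral_const_mul' _ _ (by finiteness [pow_ne_zero n hρ0])]
          calc (ρ ^ n)⁻¹ * ∫⁻ ω, u n ω ^ s ∂Q ≤ (ρ ^ n)⁻¹ * (C * ξ ^ n) := by gcongr; exact h n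
            _ = C * (ξ / ρ) ^ n := by
              rw [div_eq_mul_inv, mul_pow, ENNReal.inv_pow]; ring
      _ = C * (1 - ξ / ρ)⁻¹ := by rw [ENNReal.tsum_mul_left, ENNReal.tsum_geometric]
      _ < ∞ := by
          refine ENNReal.mul_lt_top hC.lt_top (ENNReal.inv_lt_top.2 (tsub_pos_of_lt ?_))
          rwa [ENNReal.div_lt_iff (Or.inl hρ0) (Or.inl hρt), one_mul]
  set κ : ℝ≥0∞ := ρ ^ (1 / s)
  have hκ : κ < 1 := ENNReal.rpow_lt_one hρ2 (by positivity)
  have hK : (1 - κ)⁻¹ ^ s < ∞ :=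
    ENNReal.rpow_lt_top_of_nonneg hs.le (ENNReal.inv_lt_top.2 (tsub_pos_of_lt hκ)).ne
  calc ∫⁻ ω, (∑' n, u n ω) ^ s ∂Q ≤ ∫⁻ ω, (1 - κ)⁻¹ ^ s * S ω ∂Q := by
        refine lintegral_mono fun ω => ?_
        have hle : ∀ n, u n ω ≤ κ ^ n * S ω ^ (1 / s) := fun n => by
          have h1 : u n ω ^ s ≤ ρ ^ n * S ω := by
            have := ENNReal.le_tsum (f := fun n => (ρ ^ n)⁻¹ * u n ω ^ s) n
            calc u n ω ^ s = ρ ^ n * ((ρ ^ n)⁻¹ * u n ω ^ s) := by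
                  rw [← mul_assoc, ENNReal.mul_inv_cancel (pow_ne_zero n hρ0)
                    (ENNReal.pow_ne_top hρt), one_mul]
              _ ≤ _ := by gcongr
          calc u n ω = (u n ω ^ s) ^ (1 / s) := by
                rw [← ENNReal.rpow_mul, mul_one_div_cancel hs.ne', ENNReal.rpow_one]
            _ ≤ (ρ ^ n * S ω) ^ (1 / s) := by gcongr
            _ = _ := by
                rw [ENNReal.mul_rpow_of_nonneg _ _ (by positivity), ← ENNReal.rpow_natCast_mul,
                  ← ENNReal.rpow_mul_natCast, mul_comm (n : ℝ)]
        calc (∑' n, u n ω) ^ s ≤ (∑' n, κ ^ n * S ω ^ (1 / s)) ^ s := by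
              gcongr with n; exact hle n
          _ = _ := by
              rw [ENNReal.tsum_mul_right, ENNReal.tsum_geometric,
                ENNReal.mul_rpow_of_nonneg _ _ hs.le, ← ENNReal.rpow_mul,
                one_div_mul_cancel hs.ne', ENNReal.rpow_one]
    _ = (1 - κ)⁻¹ ^ s * ∫⁻ ω, S ω ∂Q := lintegral_const_mul' _ _ hK.ne
    _ < ∞ := ENNReal.mul_lt_top hK hS

/-! ### Existence of the fixed point by weighted branching -/

section FixedPoint

variable {H Ω : Type*} [NormedAddCommGroup H] [InnerProductSpace ℝ H] [MeasurableSpace H]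
  [BorelSpace H] [SecondCountableTopology H] [MeasurableSpace Ω] {s : ℝ} {m : ℕ}
  {P : Measure Ω} [IsProbabilityMeasure P] {A : Fin m → Ω → H →L[ℝ] H} {b : Ω → H}

/-- The affine recursion at the root of the tree. -/
def rootStep (A : Fin m → Ω → H →L[ℝ] H) (b : Ω → H) (V : (List (Fin m) → Ω) → H)
    (t : List (Fin m) → Ω) : H :=
  ∑ r, A r (t []) (V fun v => t (r :: v)) + b (t [])

theorem measurable_rootStep (hA : ∀ r, IsRandomOperator (A r)) (hb : Measurable b)
    {V : (List (Fin m) → Ω) → H} (hV : Measurable V) : Measurable (rootStep A b V) :=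
  (Finset.measurable_sum _ fun r _ => (hA r).measurable_apply_comp (measurable_pi_apply _)
    (hV.comp (by fun_prop))).add
    (hb.comp (measurable_pi_apply _))

/-- By self-similarity the values of `V` on the subtrees are independent copies of `V`, independent
of the root, which is exactly the input of `T`. -/
theorem map_rootStep (hA : ∀ r, IsRandomOperator (A r)) (hb : Measurable b)
    {V : (List (Fin m) → Ω) → H} (hV : Measurable V) :
    (treeMeasure m P).map (rootStep A b V) = fixedPointMap P A b ((treeMeasure m P).map V) := by
  have : IsProbabilityMeasure ((treeMeasure m P).map V) :=
    Measure.isProbabilityMeasure_map hV.aemeasurable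
  have hG := measurable_affine (g := fun _ _ x => x) hA hb fun _ => measurable_snd
  have hV' : Measurable fun (x : Fin m → List (Fin m) → Ω) r => V (x r) := by fun_prop
  have mp := measurePreserving_root_subtrees (m := m) P
  rw [fixedPointMap, ← Measure.pi_map_pi fun _ => hV.aemeasurable]
  have hprod := Measure.map_prod_map P (Measure.pi fun _ : Fin m => treeMeasure m P)
    measurable_id hV'
  rw [Measure.map_id] at hprod
  rw [hprod, ← mp.map_eq,
    Measure.map_map (measurable_id.prodMap hV') mp.measurable,
    Measure.map_map hG ((measurable_id.prodMap hV').comp mp.measurable)]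
  rfl

theorem fixedPointMap_zero_dirac (hA : ∀ r, IsRandomOperator (A r)) :
    fixedPointMap P A (fun _ => 0) (Measure.dirac 0) = Measure.dirac 0 := by
  have hG := measurable_affine (b := fun _ => (0 : H)) (g := fun _ _ x => x) hA measurable_const
    fun _ => measurable_snd
  rw [fixedPointMap, ← Measure.infinitePi_eq_pi, Measure.infinitePi_dirac, Measure.prod_dirac, Measure.map_map hG (by fun_prop)]
  have : ((fun p : Ω × (Fin m → H) => ∑ r, A r p.1 (p.2 r) + (0 : H)) ∘
      fun x => (x, fun _ : Fin m => (0 : H))) = fun _ => 0 := by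
    funext ω; simp
  rw [this]
  simp

/-- Partial sums of the weighted branching representation of the fixed point. -/
def treeSum (A : Fin m → Ω → H →L[ℝ] H) (b : Ω → H) : ℕ → (List (Fin m) → Ω) → H
  | 0 => fun _ => 0
  | n + 1 => rootStep A b (treeSum A b n)

theorem measurable_treeSum (hA : ∀ r, IsRandomOperator (A r)) (hb : Measurable b) (n : ℕ) :
    Measurable (treeSum A b n) := by
  induction n with
  | zero => exact measurable_const
  | succ n ih => exact measurable_rootStep hA hb ih

theorem dirac_zero_mem_Ps (hs : 0 < s) : Measure.dirac (0 : H) ∈ Ps H s :=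
  ⟨inferInstance, by rw [lintegral_dirac' _ (by fun_prop)]; simp [hs]⟩

theorem treeSum_succ_sub (n : ℕ) :
    (fun t => treeSum A b (n + 2) t - treeSum A b (n + 1) t) =
      rootStep A (fun _ => 0) fun t => treeSum A b (n + 1) t - treeSum A b n t := by
  funext t
  simp [treeSum, rootStep]

/-- The laws of the increments are the iterates, under the map with `b = 0`, of the law of `b`. That
map fixes `δ_0` and contracts `ζ_s`, and `ζ_s(·, δ_0)` dominates the `s`-th moment up to the factor
`8`. Centering of `b` for `s > 1` makes the initial distance finite. -/
theorem lintegral_treeSum_sub_le [CompleteSpace H] (hs : 0 < s) (hs2 : s ≤ 2)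
    (hA : ∀ r, IsRandomOperator (A r)) (hAs : ∀ r, ∫⁻ ω, ‖A r ω‖ₑ ^ s ∂P < ∞)
    (hb : Measurable b) (hbs : ∫⁻ ω, ‖b ω‖ₑ ^ s ∂P < ∞) (hb0 : 1 < s → ∫ ω, b ω ∂P = 0) :
    ∃ C : ℝ≥0∞, C ≠ ∞ ∧ ∀ n, ∫⁻ t, ‖treeSum A b (n + 1) t - treeSum A b n t‖ₑ ^ s
      ∂treeMeasure m P ≤ C * (∫⁻ ω, ∑ r, ‖A r ω‖ₑ ^ s ∂P) ^ n := by
  have h0 : ∫⁻ _ : Ω, ‖(0 : H)‖ₑ ^ s ∂P < ∞ := by simp [hs]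
  have hD : ∀ n, Measurable fun t => treeSum A b (n + 1) t - treeSum A b n t := fun n =>
    (measurable_treeSum hA hb _).sub (measurable_treeSum hA hb _)
  set law : ℕ → Measure H := fun n =>
    (treeMeasure m P).map fun t => treeSum A b (n + 1) t - treeSum A b n t with hlaw
  have hlaw0 : law 0 = P.map b := by
    rw [← (measurePreserving_root (m := m) P).map_eq, Measure.map_map hb (by fun_prop), hlaw]
    refine congrArg (fun g => Measure.map g (treeMeasure m P)) ?_
    funext t
    simp [treeSum, rootStep]
  have hlawS : ∀ n, law (n + 1) = fixedPointMap P A (fun _ => 0) (law n) := fun n => by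
    rw [hlaw]
    simp only [treeSum_succ_sub]
    exact map_rootStep hA measurable_const (hD n)
  have hmem : ∀ n, law n ∈ Ps H s := fun n => by
    induction n with
    | zero =>
      rw [hlaw0]
      exact ⟨Measure.isProbabilityMeasure_map hb.aemeasurable,
        by rwa [lintegral_map (by fun_prop) hb]⟩
    | succ n ih => rw [hlawS]; exact fixedPointMap_mem_Ps hs hA hAs measurable_const h0 ih
  have hcen : 1 < s → ∫ x, x ∂law 0 = 0 := fun h => by
    rw [hlaw0, integral_map hb.aemeasurable (by fun_prop), hb0 h]
  have hz : ∀ n, zolotarev s (law n) (Measure.dirac 0) ≤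
      (∫⁻ ω, ∑ r, ‖A r ω‖ₑ ^ s ∂P) ^ n * zolotarev s (law 0) (Measure.dirac 0) := fun n => by
    induction n with
    | zero => simp
    | succ n ih =>
      have := zolotarev_fixedPointMap_le hs hs2 hA hAs measurable_const h0 (hmem n)
        (dirac_zero_mem_Ps hs)
      rw [fixedPointMap_zero_dirac hA, ← hlawS] at this
      rw [pow_succ', mul_assoc]
      exact this.trans (by gcongr)
  have hfin : zolotarev s (law 0) (Measure.dirac 0) < ∞ :=
    zolotarev_lt_top hs hs2 (hmem 0) (dirac_zero_mem_Ps hs) fun h => by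
      rw [hcen h, integral_dirac]
  refine ⟨8 * zolotarev s (law 0) (Measure.dirac 0), by finiteness, fun n => ?_⟩
  rw [← lintegral_map (f := fun x : H => ‖x‖ₑ ^ s) (by fun_prop) (hD n)]
  calc _ ≤ 8 * zolotarev s (law n) (Measure.dirac 0) :=
        lintegral_enorm_rpow_le_zolotarev hs hs2 (hmem n).2
    _ ≤ _ := by
        rw [mul_assoc, mul_comm (zolotarev _ _ _)]
        gcongr
        exact hz n

theorem exists_fixedPoint [CompleteSpace H] (hs : 0 < s) (hs2 : s ≤ 2)
    (hA : ∀ r, IsRandomOperator (A r)) (hAs : ∫⁻ ω, ∑ r, ‖A r ω‖ₑ ^ s ∂P < 1)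
    (hb : Measurable b) (hbs : ∫⁻ ω, ‖b ω‖ₑ ^ s ∂P < ∞) (hb0 : 1 < s → ∫ ω, b ω ∂P = 0) :
    ∃ ν ∈ Ps H s, (1 < s → ∫ x, x ∂ν = 0) ∧ fixedPointMap P A b ν = ν := by
  have hAr : ∀ r, ∫⁻ ω, ‖A r ω‖ₑ ^ s ∂P < ∞ := fun r =>
    (lintegral_mono fun ω => Finset.single_le_sum (f := fun r => ‖A r ω‖ₑ ^ s)
      (fun _ _ => zero_le) (Finset.mem_univ r)).trans_lt (hAs.trans ENNReal.one_lt_top)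
  have hW := measurable_treeSum (A := A) hA hb
  obtain ⟨C, hC, hD⟩ := lintegral_treeSum_sub_le hs hs2 hA hAr hb hbs hb0
  set F : (List (Fin m) → Ω) → ℝ≥0∞ := fun t =>
    ∑' n, ‖treeSum A b (n + 1) t - treeSum A b n t‖ₑ with hF
  have hFm : Measurable F := Measurable.tsum fun n => ((hW _).sub (hW _)).enorm
  have hFs : ∫⁻ t, F t ^ s ∂treeMeasure m P < ∞ :=
    lintegral_tsum_rpow_lt_top (fun n => ((hW _).sub (hW _)).enorm) hs hC hAs hD
  have hFfin : ∀ᵐ t ∂treeMeasure m P, F t < ∞ := by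
    filter_upwards [ae_lt_top (hFm.pow_const s) hFs.ne] with t ht
    exact (ENNReal.rpow_lt_top_iff_of_pos hs).1 ht
  have htel : ∀ n t, treeSum A b n t
      = ∑ k ∈ Finset.range n, (treeSum A b (k + 1) t - treeSum A b k t) := fun n t => by
    rw [Finset.sum_range_sub (fun k => treeSum A b k t)]
    simp [treeSum]
  have hWF : ∀ n t, ‖treeSum A b n t‖ₑ ≤ F t := fun n t => by
    rw [htel]
    exact (enorm_sum_le _ _).trans (ENNReal.sum_le_tsum _)
  have hconv : ∀ᵐ t ∂treeMeasure m P, ∃ l, Tendsto (fun n => treeSum A b n t) atTop (𝓝 l) := by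
    filter_upwards [hFfin] with t ht
    have hsum : Summable fun k => treeSum A b (k + 1) t - treeSum A b k t :=
      Summable.of_nnnorm (ENNReal.tsum_coe_ne_top_iff_summable.1 ht.ne)
    refine ⟨∑' k, (treeSum A b (k + 1) t - treeSum A b k t), ?_⟩
    exact hsum.hasSum.tendsto_sum_nat.congr fun n => (htel n t).symm
  obtain ⟨W, hWm, hlim⟩ := measurable_limit_of_tendsto_metrizable_ae
    (fun n => (hW n).aemeasurable) hconv
  have hWle : ∀ᵐ t ∂treeMeasure m P, ‖W t‖ₑ ≤ F t := by
    filter_upwards [hlim] with t ht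
    exact le_of_tendsto' ht.enorm fun n => hWF n t
  have hmem : (treeMeasure m P).map W ∈ Ps H s := by
    refine ⟨Measure.isProbabilityMeasure_map hWm.aemeasurable, ?_⟩
    rw [lintegral_map (by fun_prop) hWm]
    refine (lintegral_mono_ae ?_).trans_lt hFs
    filter_upwards [hWle] with t ht
    gcongr
  refine ⟨(treeMeasure m P).map W, hmem, fun h1 => ?_, ?_⟩
  · have hcen : ∀ n, (treeMeasure m P).map (treeSum A b n) ∈ Ps H s ∧
        ∫ x, x ∂(treeMeasure m P).map (treeSum A b n) = 0 := fun n => by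
      induction n with
      | zero =>
        have : (treeMeasure m P).map (treeSum A b 0) = Measure.dirac 0 := by
          simp [treeSum]
        rw [this]
        exact ⟨dirac_zero_mem_Ps hs, integral_dirac _ _⟩
      | succ n ih =>
        rw [treeSum, map_rootStep hA hb (hW n)]
        exact ⟨fixedPointMap_mem_Ps hs hA hAr hb hbs ih.1,
          (integral_fixedPointMap h1.le hA hAr hb hbs ih.1 ih.2).trans (hb0 h1)⟩
    -- `F ≤ 1 + F ^ s` as `s > 1`; so `F` is an integrable majorant and the zero means pass to the
    -- limit.
    have hF1 : ∫⁻ t, F t ∂treeMeasure m P ≠ ∞ := by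
      refine ((lintegral_mono (g := fun t => 1 + F t ^ s) fun t => ?_).trans_lt ?_).ne
      · rcases le_total (F t) 1 with h | h
        · exact h.trans le_self_add
        · exact le_trans (by simpa using ENNReal.rpow_le_rpow_of_exponent_le h h1.le)
            le_add_self
      · rw [lintegral_add_left measurable_const]
        simpa using hFs
    have hdom := tendsto_integral_of_dominated_convergence (fun t => (F t).toReal)
      (fun n => (hW n).aestronglyMeasurable)
      (integrable_toReal_of_lintegral_ne_top hFm.aemeasurable hF1)
      (fun n => by
        filter_upwards [hFfin] with t ht
        rw [← toReal_enorm]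
        exact ENNReal.toReal_mono ht.ne (hWF n t)) hlim
    have hzero : ∀ n, ∫ t, treeSum A b n t ∂treeMeasure m P = 0 := fun n => by
      rw [← (hcen n).2, integral_map (hW n).aemeasurable (by fun_prop)]
    simp only [hzero] at hdom
    rw [integral_map hWm.aemeasurable (by fun_prop)]
    exact tendsto_nhds_unique hdom tendsto_const_nhds
  · rw [← map_rootStep hA hb hWm]
    refine Measure.map_congr ?_
    -- Passing to a subtree preserves the measure, so the iterates converge almost surely on all
    -- subtrees at once; continuity of the operators then takes the limit in the root recursion.
    have hsub : ∀ᵐ t ∂treeMeasure m P, ∀ r : Fin m,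
        Tendsto (fun n => treeSum A b n fun v => t (r :: v)) atTop (𝓝 (W fun v => t (r :: v))) :=
      ae_all_iff.2 fun r => (measurePreserving_subtree P r).quasiMeasurePreserving.ae hlim
    filter_upwards [hlim, hsub] with t ht htr
    refine tendsto_nhds_unique ?_ ((tendsto_add_atTop_iff_nat 1).2 ht)
    exact (tendsto_finsetSum _ fun r _ => ((A r (t [])).continuous.tendsto _).comp
      (htr r)).add_const _

end FixedPoint

/-! ### Conditioning the recurrence on its coefficients -/

section Decoupling

theorem map_eq_of_indepFun {Ω Ω' T H : Type*} [MeasurableSpace Ω] [MeasurableSpace Ω']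
    [MeasurableSpace T] [MeasurableSpace H] {P : Measure Ω} [IsProbabilityMeasure P]
    {φ : Ω → Ω'} {Z : Ω → T} (hφ : Measurable φ) (hZ : Measurable Z) (h : IndepFun φ Z P)
    {G : Ω' × T → H} (hG : Measurable G) :
    P.map (fun ω => G (φ ω, Z ω)) = (P.prod (P.map Z)).map fun p => G (φ p.1, p.2) := by
  have : IsProbabilityMeasure (P.map Z) := Measure.isProbabilityMeasure_map hZ.aemeasurable
  have h1 := (indepFun_iff_map_prod_eq_prod_map_map hφ.aemeasurable hZ.aemeasurable).1 h
  have h2 := Measure.map_prod_map P (P.map Z) hφ measurable_id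
  rw [Measure.map_id] at h2
  calc P.map (fun ω => G (φ ω, Z ω)) = (P.map fun ω => (φ ω, Z ω)).map G :=
        (Measure.map_map hG (hφ.prodMk hZ)).symm
    _ = _ := by
        rw [h1, h2, Measure.map_map hG (hφ.prodMap measurable_id)]
        rfl

variable {H Ω Ω₀ : Type*} [NormedAddCommGroup H] [InnerProductSpace ℝ H] [MeasurableSpace H]
  [BorelSpace H] [SecondCountableTopology H] [MeasurableSpace Ω] [MeasurableSpace Ω₀]
  {m : ℕ} {P₀ : Measure Ω₀} {P : Measure Ω} [IsProbabilityMeasure P] {n₀ : ℕ}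
  {X : ℕ → Ω₀ → H} {A : ℕ → Fin m → Ω → H →L[ℝ] H} {b : ℕ → Ω → H} {I : ℕ → Fin m → Ω → ℕ}
  {Y : Fin m → ℕ → Ω → H}

theorem measurable_eval_index {I : Ω → ℕ} (hI : Measurable I) :
    Measurable fun p : Ω × (ℕ → H) => p.2 (I p.1) := by
  have : Measurable fun q : ℕ × (ℕ → H) => q.2 q.1 :=
    measurable_from_prod_countable_right fun k => measurable_pi_apply k
  exact this.comp ((hI.comp measurable_fst).prodMk measurable_snd)

theorem comap_seq_eq_seqSigma (Y : ℕ → Ω → H) :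
    MeasurableSpace.comap (fun ω j => Y j ω) MeasurableSpace.pi = seqSigma Y := by
  rw [MeasurableSpace.pi, MeasurableSpace.comap_iSup]
  simp only [MeasurableSpace.comap_comp]
  rfl

/-- The coefficients are represented by the identity map from `Ω` to `Ω` with the smaller
`σ`-algebra `coeffSigma`, so no measurable structure on the space of operators is needed. The affine
expression is jointly measurable already for this `σ`-algebra, and independence gives the product
law. -/
theorem SatisfiesRecurrence.map_eq_affineLaw (h : SatisfiesRecurrence P₀ P n₀ X A b I Y) {n : ℕ}
    (hn : n₀ ≤ n) :
    P₀.map (X n) = affineLaw P (fun r => P.map fun ω j => Y r j ω) (A n) (b n)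
      fun r ω y => y (I n r ω) := by
  have hYm : ∀ r, Measurable fun ω j => Y r j ω := fun r =>
    measurable_pi_lambda _ fun j => h.measurable_Y r j
  have hle : coeffSigma (A n) (b n) (I n) ≤ (inferInstance : MeasurableSpace Ω) := by
    refine sup_le (sup_le (iSup₂_le fun r x => ?_) ?_) (iSup_le fun r => ?_)
    · exact (h.measurable_A n hn r x).comap_le
    · exact (h.measurable_b n hn).comap_le
    · exact (h.measurable_I n hn r).comap_le
  have hleY : ∀ r, seqSigma (Y r) ≤ (inferInstance : MeasurableSpace Ω) := fun r =>
    iSup_le fun j => (h.measurable_Y r j).comap_le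
  have hind := h.indep n hn
  have hYind : iIndepFun (fun r ω j => Y r j ω) P := by
    have : iIndep (fun r => seqSigma (Y r)) P := by
      have h' := hind.precomp (Option.some_injective (Fin m))
      exact h'
    simpa only [iIndepFun_iff_iIndep, comap_seq_eq_seqSigma] using this
  have hYlaw : P.map (fun ω r j => Y r j ω) = Measure.pi fun r => P.map fun ω j => Y r j ω :=
    (iIndepFun_iff_map_fun_eq_pi_map fun r => (hYm r).aemeasurable).1 hYind
  have hcoeff : @IndepFun Ω Ω (Fin m → ℕ → H) _ (coeffSigma (A n) (b n) (I n)) _ id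
      (fun ω r j => Y r j ω) P := by
    have hi : Indep (coeffSigma (A n) (b n) (I n)) (⨆ r, seqSigma (Y r)) P := by
      have := indep_iSup_of_disjoint (S := {none}) (T := Set.range some)
        (fun i => by cases i with | none => exact hle | some r => exact hleY r) hind (by simp)
      rwa [iSup_range, iSup_singleton] at this
    have hcomap : MeasurableSpace.comap (fun ω r j => Y r j ω) MeasurableSpace.pi
        = ⨆ r, seqSigma (Y r) := by
      rw [MeasurableSpace.pi, MeasurableSpace.comap_iSup]
      simp only [MeasurableSpace.comap_comp]
      exact iSup_congr fun r => comap_seq_eq_seqSigma (Y r)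
    refine (@IndepFun_iff_Indep Ω Ω (Fin m → ℕ → H) _ (coeffSigma (A n) (b n) (I n)) _
      id _ P).2 ?_
    rwa [@MeasurableSpace.comap_id Ω (coeffSigma (A n) (b n) (I n)), hcomap]
  have hG : Measurable[(coeffSigma (A n) (b n) (I n)).prod MeasurableSpace.pi]
      fun p : Ω × (Fin m → ℕ → H) => ∑ r, A n r p.1 (p.2 r (I n r p.1)) + b n p.1 := by
    refine @measurable_affine H Ω _ _ _ _ _ (coeffSigma (A n) (b n) (I n)) (ℕ → H) _ m
      (A n) (b n) (fun r ω y => y (I n r ω)) (fun r x => ?_) ?_ fun r => ?_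
    · exact (comap_measurable _).mono (le_sup_of_le_left (le_sup_of_le_left
        (le_iSup₂_of_le r x le_rfl))) le_rfl
    · exact (comap_measurable _).mono (le_sup_of_le_left le_sup_right) le_rfl
    · refine @measurable_eval_index H Ω _ _ _ _ _ (coeffSigma (A n) (b n) (I n)) (I n r) ?_
      exact (comap_measurable _).mono (le_sup_of_le_right (le_iSup_of_le r le_rfl)) le_rfl
  rw [(h.recurrence n hn).map_eq, affineLaw, ← hYlaw]
  exact @map_eq_of_indepFun Ω Ω (Fin m → ℕ → H) H _ (coeffSigma (A n) (b n) (I n)) _ _ P _ id _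
    (measurable_id'' hle) (measurable_pi_lambda _ hYm) hcoeff _ hG

variable {s : ℝ}

theorem SatisfiesRecurrence.map_eval_index (h : SatisfiesRecurrence P₀ P n₀ X A b I Y) (r : Fin m)
    (j : ℕ) : (P.map fun ω j => Y r j ω).map (fun y => y j) = P₀.map (X j) := by
  rw [Measure.map_map (measurable_pi_apply j) (measurable_pi_lambda _ fun j => h.measurable_Y r j),
    ← (h.copies r j).map_eq]
  rfl

theorem SatisfiesRecurrence.integral_map_eq (h : SatisfiesRecurrence P₀ P n₀ X A b I Y) {n : ℕ}
    (hn : n₀ ≤ n) {E : Type*} [NormedAddCommGroup E] [NormedSpace ℝ E] {f : H → E}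
    (hf : Continuous f) (hi : Integrable f (P₀.map (X n))) :
    Integrable (fun ω => ∫ x, f (∑ r, A n r ω (x r) + b n ω)
        ∂Measure.pi fun r => P₀.map (X (I n r ω))) P ∧
      ∫ x, f x ∂P₀.map (X n) = ∫ ω, ∫ x, f (∑ r, A n r ω (x r) + b n ω)
        ∂(Measure.pi fun r => P₀.map (X (I n r ω))) ∂P := by
  have hYm : ∀ r, Measurable fun ω j => Y r j ω := fun r =>
    measurable_pi_lambda _ fun j => h.measurable_Y r j
  have : ∀ r, IsProbabilityMeasure (P.map fun ω j => Y r j ω) := fun r =>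
    Measure.isProbabilityMeasure_map (hYm r).aemeasurable
  rw [h.map_eq_affineLaw hn] at hi
  have := integral_affineLaw (h.measurable_A n hn) (h.measurable_b n hn)
    (fun r => measurable_eval_index (h.measurable_I n hn r)) hf hi
  rw [← h.map_eq_affineLaw hn] at this
  simpa only [h.map_eval_index] using this

theorem SatisfiesRecurrence.integral_b_eq_zero [CompleteSpace H]
    (h : SatisfiesRecurrence P₀ P n₀ X A b I Y) (hs : 1 ≤ s)
    (hX : ∀ n, P₀.map (X n) ∈ Ps H s) (h0 : ∀ n, ∫ x, x ∂P₀.map (X n) = 0) {n : ℕ}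
    (hn : n₀ ≤ n) : ∫ ω, b n ω ∂P = 0 := by
  have := fun n => (hX n).1
  have hi := fun n => integrable_of_one_le (U := fun x : H => x) aemeasurable_id hs (hX n).2
  rw [← h0 n, (h.integral_map_eq (f := fun x => x) hn continuous_id (hi n)).2]
  exact integral_congr_ae (ae_of_all _ fun ω =>
    (integral_sum_add_pi _ _ (fun _ => hi _) fun _ => h0 _).symm)

/-- Both laws are mixtures over the same `ω`; given `ω`, they differ only in the laws of the
independent summands. -/
theorem SatisfiesRecurrence.zolotarev_le (h : SatisfiesRecurrence P₀ P n₀ X A b I Y) (hs : 0 < s)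
    (hs2 : s ≤ 2) (hX : ∀ n, P₀.map (X n) ∈ Ps H s) {n : ℕ} (hn : n₀ ≤ n)
    (hA : ∀ r, ∫⁻ ω, ‖A n r ω‖ₑ ^ s ∂P < ∞) (hb : ∫⁻ ω, ‖b n ω‖ₑ ^ s ∂P < ∞)
    {ν : Measure H} (hν : ν ∈ Ps H s) :
    zolotarev s (P₀.map (X n)) (fixedPointMap P (A n) (b n) ν) ≤
      ∫⁻ ω, ∑ r, ‖A n r ω‖ₑ ^ s * zolotarev s (P₀.map (X (I n r ω))) ν ∂P := by
  refine HilbertContraction.zolotarev_le fun f hf => ?_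
  have := fun n => (hX n).1
  have := hν.1
  have hT := fixedPointMap_mem_Ps hs (h.measurable_A n hn) hA (h.measurable_b n hn) hb hν
  have := hT.1
  have h1 := h.integral_map_eq hn hf.continuous
    (hf.integrable_comp hs hs2 (U := fun x : H => x) aemeasurable_id (hX n).2)
  have hi := hf.integrable_comp hs hs2 (U := fun x : H => x) aemeasurable_id hT.2
  rw [fixedPointMap_eq_affineLaw] at hi
  have h2 := integral_affineLaw (h.measurable_A n hn) (h.measurable_b n hn)
    (fun _ => measurable_snd) hf.continuous hi
  rw [← fixedPointMap_eq_affineLaw] at h2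
  simp only [Measure.map_id'] at h2
  rw [h1.2, h2.2]
  exact enorm_integral_sub_le_lintegral h1.1 h2.1 fun ω =>
    enorm_integral_pi_sub_le hs hs2 hf _ _ (fun _ => hX _) fun _ => hν

end Decoupling

/-! ### Averaged recursive inequalities for numerical sequences -/

section Sequence

theorem le_inv_one_sub_mul_of_le_mul_add {x q c : ℝ≥0∞} (hx : x ≠ ∞) (hq : q < 1)
    (h : x ≤ q * x + c) : x ≤ (1 - q)⁻¹ * c := by
  have h1 : (1 - q) * x ≤ c := by
    rw [ENNReal.sub_mul fun _ _ => hx, one_mul]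
    exact tsub_le_iff_left.2 h
  have h2 : 1 - q ≠ 0 := (tsub_pos_of_lt hq).ne'
  have h3 : 1 - q ≠ ∞ := by finiteness
  calc x = (1 - q)⁻¹ * ((1 - q) * x) := by
        rw [← mul_assoc, ENNReal.inv_mul_cancel h2 h3, one_mul]
    _ ≤ _ := by gcongr

variable {Ω : Type*} [MeasurableSpace Ω] {P : Measure Ω} {m n₀ : ℕ}
  {d e : ℕ → ℝ≥0∞} {w : ℕ → Fin m → Ω → ℝ≥0∞} {I : ℕ → Fin m → Ω → ℕ} {q : ℝ≥0∞}

/-- Strong induction. The index may equal `n`, so the right side can contain `d n` itself; if `d n`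
exceeded the bound, it would dominate all terms, and `d n ≤ q * d n + 1` would contradict this. -/
theorem bounded_of_averaged_recursion (hd : ∀ n, d n ≠ ∞) (hq : q < 1)
    (hw : ∀ n ≥ n₀, ∀ r, Measurable (w n r))
    (hI : ∀ n ≥ n₀, ∀ r, ∀ᵐ ω ∂P, I n r ω ≤ n)
    (hrec : ∀ n ≥ n₀, d n ≤ ∫⁻ ω, ∑ r, w n r ω * d (I n r ω) ∂P + e n)
    (he : Tendsto e atTop (𝓝 0)) (hwq : ∀ᶠ n in atTop, ∫⁻ ω, ∑ r, w n r ω ∂P ≤ q) :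
    ∃ K : ℝ≥0∞, K ≠ ∞ ∧ ∀ n, d n ≤ K := by
  obtain ⟨N, hN⟩ := eventually_atTop.1
    ((hwq.and (he.eventually (ge_mem_nhds zero_lt_one))).and (eventually_ge_atTop n₀))
  refine ⟨(1 - q)⁻¹ * 1 + ∑ j ∈ Finset.range N, d j, ?_, fun n => ?_⟩
  · exact ENNReal.add_ne_top.2 ⟨ENNReal.mul_ne_top (ENNReal.inv_ne_top.2 (tsub_pos_of_lt hq).ne')
      ENNReal.one_ne_top, ENNReal.sum_ne_top.2 fun j _ => hd j⟩
  induction n using Nat.strong_induction_on with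
  | _ n ih =>
    set K := (1 - q)⁻¹ * 1 + ∑ j ∈ Finset.range N, d j
    rcases lt_or_ge n N with hn | hn
    · exact (Finset.single_le_sum (f := d) (fun _ _ => zero_le) (Finset.mem_range.2 hn)).trans
        le_add_self
    obtain ⟨⟨hw1, he1⟩, hn0⟩ := hN n hn
    by_contra! hlt
    have hle : ∀ᵐ ω ∂P, ∀ r, d (I n r ω) ≤ d n := by
      filter_upwards [ae_all_iff.2 (hI n hn0)] with ω hω r
      rcases (hω r).lt_or_eq with h | h
      · exact (ih _ h).trans hlt.le
      · rw [h]
    have h1 : d n ≤ q * d n + 1 := by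
      refine (hrec n hn0).trans (add_le_add ?_ he1)
      calc ∫⁻ ω, ∑ r, w n r ω * d (I n r ω) ∂P ≤ ∫⁻ ω, (∑ r, w n r ω) * d n ∂P := by
            refine lintegral_mono_ae ?_
            filter_upwards [hle] with ω hω
            rw [Finset.sum_mul]
            gcongr with r
            exact hω r
        _ = (∫⁻ ω, ∑ r, w n r ω ∂P) * d n :=
            lintegral_mul_const _ (Finset.measurable_sum _ fun r _ => hw n hn0 r)
        _ ≤ q * d n := by gcongr
    exact absurd ((le_inv_one_sub_mul_of_le_mul_add (hd n) hq h1).trans le_self_add) hlt.not_ge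

theorem tendsto_zero_of_averaged_recursion (hd : ∀ n, d n ≠ ∞) (hq : q < 1)
    (hw : ∀ n ≥ n₀, ∀ r, Measurable (w n r)) (hIm : ∀ n ≥ n₀, ∀ r, Measurable (I n r))
    (hI : ∀ n ≥ n₀, ∀ r, ∀ᵐ ω ∂P, I n r ω ≤ n)
    (hrec : ∀ n ≥ n₀, d n ≤ ∫⁻ ω, ∑ r, w n r ω * d (I n r ω) ∂P + e n)
    (he : Tendsto e atTop (𝓝 0)) (hwq : ∀ᶠ n in atTop, ∫⁻ ω, ∑ r, w n r ω ∂P ≤ q)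
    (hsmall : ∀ l r, Tendsto (fun n => ∫⁻ ω in {ω | I n r ω ≤ l}, w n r ω ∂P) atTop (𝓝 0)) :
    Tendsto d atTop (𝓝 0) := by
  obtain ⟨K, hK, hdK⟩ := bounded_of_averaged_recursion hd hq hw hI hrec he hwq
  set L := limsup d atTop
  have hLK : L ≤ K := limsup_le_of_le (h := Eventually.of_forall hdK)
  have hstep : ∀ c, L < c → L ≤ q * c := by
    intro c hc
    obtain ⟨l, hl⟩ := eventually_atTop.1 (eventually_lt_of_limsup_lt hc)
    -- Indices up to `l` have vanishing weight and `d ≤ K`; indices from `l` on have total weight at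
    -- most `q` and `d < c`.
    have hlim : Tendsto (fun n => (∑ r, ∫⁻ ω in {ω | I n r ω ≤ l}, w n r ω ∂P) * K + q * c + e n)
        atTop (𝓝 (q * c)) := by
      have h1 := tendsto_finsetSum Finset.univ fun r _ => hsmall l r
      have h2 := ENNReal.Tendsto.mul_const (b := K) h1 (Or.inr hK)
      simpa using (h2.add_const (q * c)).add he
    rw [← hlim.limsup_eq]
    refine limsup_le_limsup ?_
    filter_upwards [hwq, eventually_ge_atTop n₀] with n hn hn0
    refine (hrec n hn0).trans (add_le_add_left ?_ _)
    have hms : ∀ r, MeasurableSet {ω | I n r ω ≤ l} := fun r =>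
      hIm n hn0 r measurableSet_Iic
    calc ∫⁻ ω, ∑ r, w n r ω * d (I n r ω) ∂P
        ≤ ∫⁻ ω, ((∑ r, {ω | I n r ω ≤ l}.indicator (w n r) ω) * K + (∑ r, w n r ω) * c) ∂P := by
          refine lintegral_mono fun ω => ?_
          rw [Finset.sum_mul, Finset.sum_mul, ← Finset.sum_add_distrib]
          refine Finset.sum_le_sum fun r _ => ?_
          by_cases h : I n r ω ≤ l
          · rw [Set.indicator_of_mem (by exact h)]
            exact (mul_le_mul_right (hdK _) _).trans le_self_add
          · exact (mul_le_mul_right (hl _ (le_of_not_ge h)).le _).trans le_add_self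
      _ = (∑ r, ∫⁻ ω in {ω | I n r ω ≤ l}, w n r ω ∂P) * K + (∫⁻ ω, ∑ r, w n r ω ∂P) * c := by
          rw [lintegral_add_right _ ((Finset.measurable_sum _ fun r _ => hw n hn0 r).mul_const c),
            lintegral_mul_const _ (Finset.measurable_sum _ fun r _ =>
              (hw n hn0 r).indicator (hms r)),
            lintegral_mul_const _ (Finset.measurable_sum _ fun r _ => hw n hn0 r),
            lintegral_finsetSum _ fun r _ => (hw n hn0 r).indicator (hms r)]
          simp only [lintegral_indicator (hms _)]
      _ ≤ _ := by gcongr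
  have hL : L ≤ q * L + 0 := by
    rw [add_zero]
    refine ENNReal.le_of_forall_pos_le_add fun ε hε _ => ?_
    have hLt : L ≠ ∞ := ne_top_of_le_ne_top hK hLK
    calc L ≤ q * (L + ε) := hstep _ (ENNReal.lt_add_right hLt (by simpa using hε.ne'))
      _ ≤ q * L + ε := by
          rw [mul_add]
          gcongr
          exact mul_le_of_le_one_left zero_le hq.le
  have h0 := le_inv_one_sub_mul_of_le_mul_add (ne_top_of_le_ne_top hK hLK) hq hL
  rw [mul_zero] at h0
  exact tendsto_of_le_liminf_of_limsup_le zero_le h0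

/-- Either `y ≤ η x` or `x ≤ η⁻¹ y`. As `η → 0` the coefficient of `x ^ s` tends to `1`, so a strict
bound below `1` on the limiting weights survives the perturbation; the factor `2 ^ s` would destroy
it. -/
theorem add_rpow_le_of_pos {s : ℝ} (hs : 0 < s) (x y : ℝ≥0∞) {η : ℝ≥0∞} (h0 : η ≠ 0)
    (ht : η ≠ ∞) : (x + y) ^ s ≤ (1 + η) ^ s * x ^ s + (η⁻¹ + 1) ^ s * y ^ s := by
  rw [← ENNReal.mul_rpow_of_nonneg _ _ hs.le, ← ENNReal.mul_rpow_of_nonneg _ _ hs.le]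
  rcases le_total y (η * x) with h | h
  · refine le_trans ?_ le_self_add
    gcongr
    rw [add_mul, one_mul]
    gcongr
  · refine le_trans ?_ le_add_self
    gcongr
    rw [add_mul, one_mul]
    gcongr
    rw [← ENNReal.mul_le_iff_le_inv h0 ht] at *
    simpa using h

theorem eventually_lintegral_sum_rpow_le {H : Type*} [NormedAddCommGroup H] {s : ℝ} (hs : 0 < s)
    {a : ℕ → Fin m → Ω → H} {a' : Fin m → Ω → H}
    (ha : ∀ n ≥ n₀, ∀ r, Measurable fun ω => ‖a n r ω - a' r ω‖ₑ)
    (ha' : ∀ r, Measurable fun ω => ‖a' r ω‖ₑ) (hlt : ∫⁻ ω, ∑ r, ‖a' r ω‖ₑ ^ s ∂P < 1)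
    (h : ∀ r, Tendsto (fun n => ∫⁻ ω, ‖a n r ω - a' r ω‖ₑ ^ s ∂P) atTop (𝓝 0)) :
    ∃ q < 1, ∀ᶠ n in atTop, ∫⁻ ω, ∑ r, ‖a n r ω‖ₑ ^ s ∂P ≤ q := by
  set ξ := ∫⁻ ω, ∑ r, ‖a' r ω‖ₑ ^ s ∂P with hξ
  have hcont : Tendsto (fun η : ℝ≥0∞ => (1 + η) ^ s * ξ) (𝓝[>] 0) (𝓝 ξ) := by
    have h1 : Tendsto (fun η : ℝ≥0∞ => (1 + η) ^ s) (𝓝 0) (𝓝 ((1 + 0) ^ s)) :=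
      (ENNReal.continuous_rpow_const.comp (continuous_const.add continuous_id)).tendsto 0
    have h2 := ENNReal.Tendsto.mul_const (b := ξ) h1 (Or.inr (hlt.trans ENNReal.one_lt_top).ne)
    simp only [add_zero, ENNReal.one_rpow, one_mul] at h2
    exact h2.mono_left nhdsWithin_le_nhds
  obtain ⟨η, ⟨hη1, hη0⟩, hηt⟩ := ((hcont.eventually (gt_mem_nhds hlt)).and
    self_mem_nhdsWithin |>.and (nhdsWithin_le_nhds (gt_mem_nhds ENNReal.zero_lt_top))).exists
  have hη0' : η ≠ 0 := (Set.mem_Ioi.1 hη0).ne'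
  have hc1 : (1 + η) ^ s ≠ ∞ := by finiteness
  have hc2 : (η⁻¹ + 1) ^ s ≠ ∞ := by finiteness
  obtain ⟨q, hq0, hq1⟩ := exists_between hη1
  refine ⟨q, hq1, ?_⟩
  have hlim : Tendsto (fun n => (1 + η) ^ s * ξ
      + (η⁻¹ + 1) ^ s * ∑ r, ∫⁻ ω, ‖a n r ω - a' r ω‖ₑ ^ s ∂P) atTop (𝓝 ((1 + η) ^ s * ξ)) := by
    have h1 := tendsto_finsetSum Finset.univ fun r _ => h r
    have h2 := (ENNReal.Tendsto.const_mul (a := (η⁻¹ + 1) ^ s) h1 (Or.inr hc2)).const_add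
      ((1 + η) ^ s * ξ)
    simpa using h2
  filter_upwards [hlim.eventually (gt_mem_nhds hq0), eventually_ge_atTop n₀] with n hn hn0
  refine le_trans ?_ hn.le
  calc ∫⁻ ω, ∑ r, ‖a n r ω‖ₑ ^ s ∂P
      ≤ ∫⁻ ω, ((1 + η) ^ s * ∑ r, ‖a' r ω‖ₑ ^ s
          + (η⁻¹ + 1) ^ s * ∑ r, ‖a n r ω - a' r ω‖ₑ ^ s) ∂P := by
        refine lintegral_mono fun ω => ?_
        rw [Finset.mul_sum, Finset.mul_sum, ← Finset.sum_add_distrib]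
        refine Finset.sum_le_sum fun r _ => le_trans ?_ (add_rpow_le_of_pos hs _ _ hη0' hηt.ne)
        gcongr
        simpa using enorm_add_le (a' r ω) (a n r ω - a' r ω)
    _ = _ := by
        rw [lintegral_add_left ((Finset.measurable_sum _ fun r _ =>
            (ha' r).pow_const s).const_mul _), lintegral_const_mul' _ _ hc1,
          lintegral_const_mul' _ _ hc2, lintegral_finsetSum _ fun r _ => (ha n hn0 r).pow_const s]

end Sequence

/-! ### Convergence of the coefficients and assembly -/

section Limit

theorem zolotarev_triangle {H : Type*} [NormedAddCommGroup H] [NormedSpace ℝ H]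
    [MeasurableSpace H] (s : ℝ) (μ ν ρ : Measure H) :
    zolotarev s μ ρ ≤ zolotarev s μ ν + zolotarev s ν ρ := by
  refine zolotarev_le fun f hf => ?_
  rw [← edist_eq_enorm_sub]
  refine (edist_triangle _ (∫ x, f x ∂ν) _).trans ?_
  rw [edist_eq_enorm_sub, edist_eq_enorm_sub]
  exact add_le_add (by simpa using hf.enorm_integral_sub_le one_pos μ ν)
    (by simpa using hf.enorm_integral_sub_le one_pos ν ρ)

theorem integral_eq_zero_of_tendsto {H Ω : Type*} [NormedAddCommGroup H] [NormedSpace ℝ H]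
    [MeasurableSpace H] [BorelSpace H] [SecondCountableTopology H] [MeasurableSpace Ω]
    {P : Measure Ω} [IsProbabilityMeasure P] {s : ℝ} (hs : 1 < s) {b : ℕ → Ω → H} {c : Ω → H}
    (hb : ∀ᶠ n in atTop, Measurable (b n) ∧ ∫⁻ ω, ‖b n ω‖ₑ ^ s ∂P < ∞ ∧ ∫ ω, b n ω ∂P = 0)
    (hc : Measurable c) (hcs : ∫⁻ ω, ‖c ω‖ₑ ^ s ∂P < ∞)
    (h : Tendsto (fun n => ∫⁻ ω, ‖b n ω - c ω‖ₑ ^ s ∂P) atTop (𝓝 0)) :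
    ∫ ω, c ω ∂P = 0 := by
  have hs0 : 0 < s := by linarith
  have hlim : Tendsto (fun n => (∫⁻ ω, ‖b n ω - c ω‖ₑ ^ s ∂P) ^ (1 / s)) atTop (𝓝 0) := by
    have := (ENNReal.continuous_rpow_const (y := 1 / s)).continuousAt.tendsto.comp h
    simpa [hs0, Function.comp_def] using this
  have hle : ∀ᶠ n in atTop, ‖∫ ω, c ω ∂P‖ₑ ≤ (∫⁻ ω, ‖b n ω - c ω‖ₑ ^ s ∂P) ^ (1 / s) := by
    filter_upwards [hb] with n ⟨hm, hns, hn0⟩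
    have hi := integrable_of_one_le hm.aemeasurable hs.le hns
    have hic := integrable_of_one_le hc.aemeasurable hs.le hcs
    calc ‖∫ ω, c ω ∂P‖ₑ = ‖∫ ω, (b n ω - c ω) ∂P‖ₑ := by
          rw [integral_sub hi hic, hn0, zero_sub, enorm_neg]
      _ ≤ ∫⁻ ω, ‖b n ω - c ω‖ₑ ∂P := enorm_integral_le_lintegral_enorm _
      _ ≤ _ := by
          simpa using ENNReal.lintegral_mul_le_Lp_mul_Lq P (Real.HolderConjugate.conjExponent hs)
            (f := fun ω => ‖b n ω - c ω‖ₑ) (g := fun _ => 1) (by fun_prop) (by fun_prop)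
  exact enorm_eq_zero.1 (le_antisymm (ge_of_tendsto hlim hle) zero_le)

variable {H Ω Ω₀ : Type*} [NormedAddCommGroup H] [InnerProductSpace ℝ H] [CompleteSpace H]
  [MeasurableSpace H] [BorelSpace H] [SecondCountableTopology H] [MeasurableSpace Ω]
  [MeasurableSpace Ω₀] {m : ℕ} {P₀ : Measure Ω₀} {P : Measure Ω} [IsProbabilityMeasure P]
  {s : ℝ}

/-- Both laws are coupled by using the same `ω` and the same arguments; the difference is again
affine, with coefficients `A n r - A' r` and `b n - b'`, so its `s`-th moment tends to `0`. -/
theorem tendsto_zolotarev_fixedPointMap (hs : 0 < s) (hs2 : s ≤ 2) {n₀ : ℕ}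
    {A : ℕ → Fin m → Ω → H →L[ℝ] H} {b : ℕ → Ω → H}
    (hA : ∀ n ≥ n₀, ∀ r, IsRandomOperator (A n r)) (hb : ∀ n ≥ n₀, Measurable (b n))
    (hAs : ∀ n ≥ n₀, ∀ r, ∫⁻ ω, ‖A n r ω‖ₑ ^ s ∂P < ∞)
    (hbs : ∀ n ≥ n₀, ∫⁻ ω, ‖b n ω‖ₑ ^ s ∂P < ∞)
    (hb0 : 1 < s → ∀ n ≥ n₀, ∫ ω, b n ω ∂P = 0)
    {A' : Fin m → Ω → H →L[ℝ] H} {b' : Ω → H} (hA' : ∀ r, IsRandomOperator (A' r))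
    (hb' : Measurable b') (hA's : ∀ r, ∫⁻ ω, ‖A' r ω‖ₑ ^ s ∂P < ∞)
    (hb's : ∫⁻ ω, ‖b' ω‖ₑ ^ s ∂P < ∞) (hb'0 : 1 < s → ∫ ω, b' ω ∂P = 0)
    (hconvA : ∀ r, Tendsto (fun n => ∫⁻ ω, ‖A n r ω - A' r ω‖ₑ ^ s ∂P) atTop (𝓝 0))
    (hconvb : Tendsto (fun n => ∫⁻ ω, ‖b n ω - b' ω‖ₑ ^ s ∂P) atTop (𝓝 0))
    {ν : Measure H} (hν : ν ∈ Ps H s) (hν0 : 1 < s → ∫ x, x ∂ν = 0) :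
    Tendsto (fun n => zolotarev s (fixedPointMap P (A n) (b n) ν) (fixedPointMap P A' b' ν))
      atTop (𝓝 0) := by
  have := hν.1
  have hmeas : ∀ n ≥ n₀, Measurable fun p : Ω × (Fin m → H) =>
      ∑ r, A n r p.1 (p.2 r) + b n p.1 := fun n hn =>
    measurable_affine (g := fun _ _ x => x) (hA n hn) (hb n hn) fun _ => measurable_snd
  have hmeas' : Measurable fun p : Ω × (Fin m → H) => ∑ r, A' r p.1 (p.2 r) + b' p.1 :=
    measurable_affine (g := fun _ _ x => x) hA' hb' fun _ => measurable_snd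
  refine tendsto_zolotarev_map hs hs2 ?_ hmeas' ?_ ?_ ?_
  · filter_upwards [eventually_ge_atTop n₀] with n hn using hmeas n hn
  · have := (fixedPointMap_mem_Ps hs hA' hA's hb' hb's hν).2
    rwa [fixedPointMap, lintegral_map (by fun_prop) hmeas'] at this
  · intro h1
    filter_upwards [eventually_ge_atTop n₀] with n hn
    have e1 := integral_fixedPointMap h1.le (hA n hn) (hAs n hn) (hb n hn) (hbs n hn) hν (hν0 h1)
    have e2 := integral_fixedPointMap h1.le hA' hA's hb' hb's hν (hν0 h1)
    rw [fixedPointMap, integral_map (hmeas n hn).aemeasurable (by fun_prop)] at e1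
    rw [fixedPointMap, integral_map hmeas'.aemeasurable (by fun_prop)] at e2
    rw [e1, e2, hb0 h1 n hn, hb'0 h1]
  · have hlim : Tendsto (fun n => 2 ^ s * ((m : ℝ≥0∞) ^ s *
        ∑ r, (∫⁻ ω, ‖A n r ω - A' r ω‖ₑ ^ s ∂P) * ∫⁻ x, ‖x‖ₑ ^ s ∂ν
          + ∫⁻ ω, ‖b n ω - b' ω‖ₑ ^ s ∂P)) atTop (𝓝 0) := by
      have h1 := tendsto_finsetSum Finset.univ fun r _ =>
        ENNReal.Tendsto.mul_const (b := ∫⁻ x, ‖x‖ₑ ^ s ∂ν) (hconvA r) (Or.inr hν.2.ne)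
      have h2 := (ENNReal.Tendsto.const_mul (a := (m : ℝ≥0∞) ^ s) h1
        (Or.inr (by finiteness))).add hconvb
      have h3 := ENNReal.Tendsto.const_mul (a := (2 : ℝ≥0∞) ^ s) h2 (Or.inr (by finiteness))
      simpa using h3
    refine tendsto_of_tendsto_of_tendsto_of_le_of_le' tendsto_const_nhds hlim
      (Eventually.of_forall fun _ => zero_le) ?_
    filter_upwards [eventually_ge_atTop n₀] with n hn
    refine le_trans (le_of_eq ?_) (lintegral_enorm_affine_rpow_le hs
      (fun r => (hA n hn r).sub (hA' r)) ((hb n hn).sub hb'))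
    refine lintegral_congr fun p => ?_
    simp only [sub_apply, Finset.sum_sub_distrib]
    congr 2
    abel

theorem exists_fixedPoint_and_tendsto [IsProbabilityMeasure P₀] (hs : 0 < s) (hs2 : s ≤ 2) {n₀ : ℕ}
    {X : ℕ → Ω₀ → H} {A : ℕ → Fin m → Ω → H →L[ℝ] H} {b : ℕ → Ω → H} {I : ℕ → Fin m → Ω → ℕ}
    {Y : Fin m → ℕ → Ω → H} (hrec : SatisfiesRecurrence P₀ P n₀ X A b I Y)
    (hX : ∀ n, ∫⁻ ω, ‖X n ω‖ₑ ^ s ∂P₀ < ∞)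
    (hA : ∀ n ≥ n₀, ∀ r, ∫⁻ ω, ‖A n r ω‖ₑ ^ s ∂P < ∞)
    (hb : ∀ n ≥ n₀, ∫⁻ ω, ‖b n ω‖ₑ ^ s ∂P < ∞)
    (hcent : 1 < s → ∀ n, ∫ ω, X n ω ∂P₀ = 0)
    {A' : Fin m → Ω → H →L[ℝ] H} {b' : Ω → H}
    (hA' : ∀ r, IsRandomOperator (A' r)) (hb' : Measurable b')
    (hconvA : ∀ r, Tendsto (fun n => ∫⁻ ω, ‖A n r ω - A' r ω‖ₑ ^ s ∂P) atTop (𝓝 0))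
    (hconvb : Tendsto (fun n => ∫⁻ ω, ‖b n ω - b' ω‖ₑ ^ s ∂P) atTop (𝓝 0))
    (hcontr : ∫⁻ ω, ∑ r, ‖A' r ω‖ₑ ^ s ∂P < 1)
    (hsmall : ∀ (l : ℕ) (r : Fin m),
      Tendsto (fun n => ∫⁻ ω in {ω | I n r ω ≤ l}, ‖A n r ω‖ₑ ^ s ∂P) atTop (𝓝 0)) :
    ∃ ν ∈ Ps H s, (1 < s → ∫ x, x ∂ν = 0) ∧ fixedPointMap P A' b' ν = ν ∧
      (∀ ν' ∈ Ps H s, (1 < s → ∫ x, x ∂ν' = 0) → fixedPointMap P A' b' ν' = ν' → ν' = ν) ∧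
      Tendsto (fun n => zolotarev s (P₀.map (X n)) ν) atTop (𝓝 0) := by
  have hA's : ∀ r, ∫⁻ ω, ‖A' r ω‖ₑ ^ s ∂P < ∞ := fun r =>
    (lintegral_mono fun ω => Finset.single_le_sum (f := fun r => ‖A' r ω‖ₑ ^ s)
      (fun _ _ => zero_le) (Finset.mem_univ r)).trans_lt (hcontr.trans ENNReal.one_lt_top)
  -- Integrability of `b'` is inherited from a `b n` at finite distance.
  have hb's : ∫⁻ ω, ‖b' ω‖ₑ ^ s ∂P < ∞ := by
    obtain ⟨n, hn, hn0⟩ := ((hconvb.eventually (gt_mem_nhds ENNReal.zero_lt_top)).and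
      (eventually_ge_atTop n₀)).exists
    refine lintegral_enorm_rpow_lt_top_of_sub hs (hrec.measurable_b n hn0) ?_ (hb n hn0)
    simpa only [enorm_sub_rev] using hn
  have hXm : ∀ n, P₀.map (X n) ∈ Ps H s := fun n =>
    ⟨Measure.isProbabilityMeasure_map (hrec.measurable_X n).aemeasurable, by
      rw [lintegral_map (by fun_prop) (hrec.measurable_X n)]; exact hX n⟩
  have hX0 : 1 < s → ∀ n, ∫ x, x ∂P₀.map (X n) = 0 := fun h n => by
    rw [integral_map (hrec.measurable_X n).aemeasurable (by fun_prop), hcent h n]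
  have hb0 : 1 < s → ∀ n ≥ n₀, ∫ ω, b n ω ∂P = 0 := fun h n hn =>
    hrec.integral_b_eq_zero h.le hXm (hX0 h) hn
  have hb'0 : 1 < s → ∫ ω, b' ω ∂P = 0 := fun h => by
    refine integral_eq_zero_of_tendsto h ?_ hb' hb's hconvb
    filter_upwards [eventually_ge_atTop n₀] with n hn
      using ⟨hrec.measurable_b n hn, hb n hn, hb0 h n hn⟩
  obtain ⟨ν, hν, hν0, hfix⟩ := exists_fixedPoint hs hs2 hA' hcontr hb' hb's hb'0
  refine ⟨ν, hν, hν0, hfix, fun ν' hν' hν'0 hfix' => ?_, ?_⟩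
  · have := hν.1
    have := hν'.1
    have hle := zolotarev_fixedPointMap_le hs hs2 hA' hA's hb' hb's hν' hν
    rw [hfix, hfix'] at hle
    have hfin := zolotarev_lt_top hs hs2 hν' hν fun h => (hν'0 h).trans (hν0 h).symm
    have h0 := le_inv_one_sub_mul_of_le_mul_add (c := 0) hfin.ne hcontr (by simpa using hle)
    exact eq_of_zolotarev_eq_zero hs hs2 (by simpa using h0)
  · obtain ⟨q, hq, hwq⟩ := eventually_lintegral_sum_rpow_le (n₀ := n₀) hs
      (fun n hn r => ((hrec.measurable_A n hn r).sub (hA' r)).measurable_enorm)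
      (fun r => (hA' r).measurable_enorm) hcontr hconvA
    refine tendsto_zero_of_averaged_recursion (w := fun n r ω => ‖A n r ω‖ₑ ^ s) (n₀ := n₀)
      (e := fun n => zolotarev s (fixedPointMap P (A n) (b n) ν) ν)
      (fun n => (zolotarev_lt_top hs hs2 (hXm n) hν fun h => (hX0 h n).trans (hν0 h).symm).ne) hq
      (fun n hn r => (hrec.measurable_A n hn r).measurable_enorm.pow_const s)
      hrec.measurable_I hrec.index_le (fun n hn => ?_) ?_ hwq hsmall
    · exact (zolotarev_triangle s _ _ _).trans (add_le_add_left
        (hrec.zolotarev_le hs hs2 hXm hn (hA n hn) (hb n hn) hν) _)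
    · have := tendsto_zolotarev_fixedPointMap hs hs2 hrec.measurable_A hrec.measurable_b hA hb hb0
        hA' hb' hA's hb's hb'0 hconvA hconvb hν hν0
      rwa [hfix] at this

end Limit

/-! ### Reduction to real scalars -/

/-- The real inner product underlying a scalar product over `𝕜`, for a given compatible real
structure. -/
@[reducible]
noncomputable def realInnerProductSpace (𝕜 H : Type*) [RCLike 𝕜] [NormedAddCommGroup H]
    [InnerProductSpace 𝕜 H] [NormedSpace ℝ H] [IsScalarTower ℝ 𝕜 H] : InnerProductSpace ℝ H where
  inner x y := RCLike.re (inner 𝕜 x y)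
  norm_sq_eq_re_inner x := by simp
  conj_inner_symm x y := by
    simpa using inner_re_symm (𝕜 := 𝕜) y x
  add_left x y z := by simp [inner_add_left]
  smul_left x y r := by
    rw [← algebraMap_smul 𝕜 r x, inner_smul_left]
    simp

end HilbertContraction

theorem theorem6p1 {𝕜 H Ω Ω₀ : Type*} [RCLike 𝕜]
    [NormedAddCommGroup H] [InnerProductSpace 𝕜 H] [NormedSpace ℝ H] [IsScalarTower ℝ 𝕜 H]
    [CompleteSpace H] [TopologicalSpace.SeparableSpace H] [MeasurableSpace H] [BorelSpace H]
    [MeasurableSpace Ω] [MeasurableSpace Ω₀]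
    (P : Measure Ω) [IsProbabilityMeasure P] (P₀ : Measure Ω₀) [IsProbabilityMeasure P₀]
    (s : ℝ) (hs : 0 < s) (hs2 : s ≤ 2) (m : ℕ) (hm : 1 ≤ m) (n₀ : ℕ) (hn₀ : 1 ≤ n₀)
    (X : ℕ → Ω₀ → H) (A : ℕ → Fin m → Ω → H →L[𝕜] H) (b : ℕ → Ω → H) (I : ℕ → Fin m → Ω → ℕ)
    (Y : Fin m → ℕ → Ω → H)
    (hrec : HilbertContraction.SatisfiesRecurrence P₀ P n₀ X A b I Y)
    -- all quantities in the recurrence are `s`-integrable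
    (hX : ∀ n, ∫⁻ ω, ‖X n ω‖ₑ ^ s ∂P₀ < ∞)
    (hA : ∀ n ≥ n₀, ∀ r, ∫⁻ ω, ‖A n r ω‖ₑ ^ s ∂P < ∞)
    (hb : ∀ n ≥ n₀, ∫⁻ ω, ‖b n ω‖ₑ ^ s ∂P < ∞)
    -- centering for `1 < s ≤ 2`
    (hcent : 1 < s → ∀ n, ∫ ω, X n ω ∂P₀ = 0)
    -- the limiting coefficients
    (Astar : Fin m → Ω → H →L[𝕜] H) (bstar : Ω → H)
    (hAstar : ∀ r, HilbertContraction.IsRandomOperator (Astar r)) (hbstar : Measurable bstar)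
    (hconvA : ∀ r, Tendsto (fun n => ∫⁻ ω, ‖A n r ω - Astar r ω‖ₑ ^ s ∂P) atTop (𝓝 0))
    (hconvb : Tendsto (fun n => ∫⁻ ω, ‖b n ω - bstar ω‖ₑ ^ s ∂P) atTop (𝓝 0))
    (hcontr : ∫⁻ ω, ∑ r, ‖Astar r ω‖ₑ ^ s ∂P < 1)
    (hsmall : ∀ (l : ℕ) (r : Fin m),
      Tendsto (fun n => ∫⁻ ω in {ω | I n r ω ≤ l}, ‖A n r ω‖ₑ ^ s ∂P) atTop (𝓝 0)) :
    ∃ ν : Measure H,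
      -- `ν = L(X)` is a fixed point of `T` in `P_s` resp. `P_{s,0}`
      ν ∈ (if s ≤ 1 then HilbertContraction.Ps H s else HilbertContraction.PsCentered H s) ∧
      HilbertContraction.fixedPointMap P Astar bstar ν = ν ∧
      -- it is the only one there
      (∀ ν' ∈ (if s ≤ 1 then HilbertContraction.Ps H s else HilbertContraction.PsCentered H s),
        HilbertContraction.fixedPointMap P Astar bstar ν' = ν' → ν' = ν) ∧
      Tendsto (fun n => HilbertContraction.zolotarev s (P₀.map (X n)) ν) atTop (𝓝 0) := by

  have : SecondCountableTopology H := UniformSpace.secondCountable_of_separable H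
  -- Built on the given real normed structure, so test functions and `ζ_s` do not change.
  -- Restriction of scalars leaves the operators unchanged as maps, hence also the `σ`-algebras, `T`
  -- and the norms.
  let _ : InnerProductSpace ℝ H := HilbertContraction.realInnerProductSpace 𝕜 H
  have hrec' : HilbertContraction.SatisfiesRecurrence (𝕜 := ℝ) P₀ P n₀ X
      (fun n r ω => (A n r ω).restrictScalars ℝ) b I Y :=
    { measurable_X := hrec.measurable_X
      measurable_A := hrec.measurable_A
      measurable_b := hrec.measurable_b
      measurable_I := hrec.measurable_I
      measurable_Y := hrec.measurable_Y
      index_le := hrec.index_le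
      copies := hrec.copies
      indep := hrec.indep
      recurrence := hrec.recurrence }
  have hnorm : ∀ a : H →L[𝕜] H, ‖a.restrictScalars ℝ‖ₑ = ‖a‖ₑ := fun a => by
    rw [← ofReal_norm, ContinuousLinearMap.norm_restrictScalars, ofReal_norm]
  have hnorm' : ∀ a a' : H →L[𝕜] H, ‖a.restrictScalars ℝ - a'.restrictScalars ℝ‖ₑ = ‖a - a'‖ₑ :=
    fun a a' => hnorm (a - a')
  obtain ⟨ν, hν, hν0, hfix, huniq, hlim⟩ :=
    HilbertContraction.exists_fixedPoint_and_tendsto hs hs2 hrec' hX (by simpa only [hnorm] using hA)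
      hb hcent (A' := fun r ω => (Astar r ω).restrictScalars ℝ) hAstar hbstar
      (by simpa only [hnorm'] using hconvA) hconvb (by simpa only [hnorm] using hcontr)
      (by simpa only [hnorm] using hsmall)
  refine ⟨ν, ?_, hfix, fun ν' hν' => ?_, hlim⟩
  · split_ifs with h
    · exact hν
    · exact ⟨hν, hν0 (not_le.1 h)⟩
  · split_ifs at hν' with h
    · exact huniq ν' hν' fun h1 => absurd h h1.not_ge
    · exact huniq ν' hν'.1 fun _ => hν'.2
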